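/- All graphs are finite and have at most one edge between two vertices; an edge may be undirected, directed ($\to$) or bidirected ($\leftrightarrow$). A partially directed cycle consists of distinct vertices $v_1,\dots,v_n$ ($n\ge 3$), $v_{n+1}=v_1$, with $v_i\to v_{i+1}$ or $v_i\leftrightarrow v_{i+1}$ for all $i$ and $v_j\to v_{j+1}$ for some $j$. An MVR chain graph is a graph with directed and bidirected edges only and without partially directed cycles. A chain (sequence of distinct, consecutively adjacent vertices) between $a,b\notin Z$ is $m$-connecting given $Z$ if every collider on it is in $Z$ or is an ancestor of a vertex of $Z$ and no noncollider on it is in $Z$; $X,Y$ are $m$-separated given $Z$ if no chain from $X$ to $Y$ is $m$-connecting given $Z$. Two MVR chain graphs are Markov equivalent if they have the same $m$-separations. A joint distribution of $(X_v)_{v\in V}$ is faithful to $G$ if, for all pairwise disjoint $X,Y,Z\subseteq V$ with $X,Y\neq\emptyset$, $X\perp\!\!\!\perp Y\mid Z$ holds in it if and only if $X,Y$ are $m$-separated given $Z$ in $G$. The algorithm receives the answers to queries "$u\perp\!\!\!\perp v\mid S$?" and works as follows. (1) Skeleton. Start with the complete undirected graph $H$ on $V$. For $i=0,\dots,|V|-2$: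 while possible, remove an edge $u - v$ such that $u\perp\!\!\!\perp v\mid S$ for some $S\subseteq ad(u)\setminus\{v\}$ with $|S|=i$, where $ad(u)$ is the set of vertices adjacent to $u$ in the current $H$ (original version) or in $H$ at the beginning of level $i$ (stable version). (2) $v$-structures. For an unshielded triple $(u,w,v)$ of $H$ let $\mathcal F$ be the collection of the sets $S\subseteq ad_H(u)$ or $S\subseteq ad_H(v)$ with $u\perp\!\!\!\perp v\mid S$. CPC: the triple is unambiguous if $\mathcal F\ne\emptyset$ and $w$ is in all or in none of the sets in $\mathcal F$, and an unambiguous triple is a $v$-structure if and only if $w$ is in none of them. MPC, with thresholds $0\le\alpha\le\beta\le100$: the triple is unambiguous if $\mathcal F\neq\emptyset$ and $w$ is in no more than $\alpha\%$ or in no less than $\beta\%$ of the sets in $\mathcal F$, and an unambiguous triple is a $v$-structure if and only if $w$ is in less than $\alpha\%$, or in none, of them. All other unshielded triples are marked as ambiguous. For every $v$-structure $(u,w,v)$ put arrowheads at $w$ on the edges $u - w$ and $v - w$. (3) While possible, apply the following rules ($*$ is an arbitrary mark). R1: if $a\,{*}\!\!\to b - c$ and $(a,b,c)$ is an unambiguous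 unshielded triple which is not a $v$-structure, orient $b\to c$. R2: if $a\,{*}\!\!\to b\,{*}\!\!\to c$ and $a,c$ are adjacent, put an arrowhead at $c$ on the edge between $a$ and $c$. R3: if $c\,{*}\!\!\to b\leftarrow\!\!{*}\,d$, $a$ is adjacent to $b,c,d$, and $(c,a,d)$ is an unambiguous unshielded triple which is not a $v$-structure, put an arrowhead at $b$ on the edge between $a$ and $b$. (4) Take a junction tree of the subgraph formed by all nodes and the undirected edges, order its cliques such that cliques closer to the root come first, order the nodes according to the first clique that contains them, and orient each undirected edge from its smaller to its larger node. All choices that are left open (the order in which edges, pairs and rules are treated, the tree, its root, ties) are arbitrary. **Theorem.** Let the distribution of $V$ be faithful to an MVR chain graph $G$, and let all queries $u\perp\!\!\!\perp v\mid S$ with $u\ne v$, $S\subseteq V\setminus\{u,v\}$ be answered correctly. Then each of the original and the stable CPC-like algorithm, and of the original and the stable MPC-like algorithm for all $0\le\alpha\le\beta\le 100$, produces an output, and for all choices made its output is an MVR chain graph $G'$ that is Markov equivalent to $G$ and has exactly the minimum set of bidirected edges for its equivalence class (every bidirected edge of $G'$ is bidirected in every MVR chain graph that is Markov equivalent to $G'$),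 with no triple marked as ambiguous. Moreover, for every unshielded triple $(u,w,v)$ of $G$, the vertex $w$ is in all sets $S\subseteq V\setminus\{u,v\}$ that $m$-separate $u$ and $v$ in $G$, or in none of them. -/

import Mathlib

open MeasureTheory ProbabilityTheory

namespace MVR

/-! ### Mixed graphs and MVR chain graphs -/

/-- A mixed graph with at most one edge between two vertices. Each edge of the skeleton carries an
arrowhead, or not, at each of its two ends; `head u v` says that `u` and `v` are joined by an edge
with an arrowhead at `v`. -/
@[ext] structure MixedGraph (V : Type*) where
  skel : SimpleGraph V
  head : V → V → Prop
  adj_of_head : ∀ {u v : V}, head u v → skel.Adj u v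

namespace MixedGraph

variable {V : Type*} (G : MixedGraph V)

/-- `u → v`. -/
def Dir (u v : V) : Prop := G.head u v ∧ ¬ G.head v u

/-- `u ↔ v`. -/
def Bidir (u v : V) : Prop := G.head u v ∧ G.head v u

/-- `u — v`. -/
def Undir (u v : V) : Prop := G.skel.Adj u v ∧ ¬ G.head u v ∧ ¬ G.head v u

/-- The set of (ordered pairs joined by) bidirected edges. -/
def bidirEdges : Set (V × V) := {e | G.Bidir e.1 e.2}

/-- There is a partially directed cycle: distinct vertices `c 0, …, c (n - 1)` with `3 ≤ n` and
`c n = c 0`, such that `c i → c (i + 1)` or `c i ↔ c (i + 1)` for all `i < n`, the former for at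
least one `i`. -/
def HasPartiallyDirectedCycle : Prop :=
  ∃ (n : ℕ) (c : ℕ → V), 3 ≤ n ∧ Set.InjOn c (Set.Iio n) ∧ c n = c 0 ∧
    (∀ i < n, G.Dir (c i) (c (i + 1)) ∨ G.Bidir (c i) (c (i + 1))) ∧
    ∃ j < n, G.Dir (c j) (c (j + 1))

/-- Multivariate regression chain graphs: every edge is directed or bidirected, and there is no
partially directed cycle. -/
structure IsMVRCG : Prop where
  no_undirected : ∀ u v, ¬ G.Undir u v
  no_pdc : ¬ G.HasPartiallyDirectedCycle

/-! ### m-separation -/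

/-- `An(Z)`: the vertices of `Z` and their ancestors. -/
def An (Z : Set V) : Set V := {a | ∃ z ∈ Z, Relation.ReflTransGen G.Dir a z}

/-- A chain between `a` and `b` (a path of the skeleton) is m-connecting given `Z`: its endpoints
are not in `Z`, its colliders are in `An(Z)` and its noncolliders are not in `Z`. -/
def MConnecting (Z : Set V) {a b : V} (q : G.skel.Walk a b) : Prop :=
  q.IsPath ∧ a ∉ Z ∧ b ∉ Z ∧ ∀ x z y, [x, z, y] <:+: q.support →
    ((G.head x z ∧ G.head y z) → z ∈ G.An Z) ∧ (¬ (G.head x z ∧ G.head y z) → z ∉ Z)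

/-- The sets `X` and `Y` are m-separated given `Z`. -/
def MSep (X Y Z : Set V) : Prop :=
  ∀ a ∈ X, ∀ b ∈ Y, ∀ q : G.skel.Walk a b, ¬ G.MConnecting Z q

end MixedGraph

/-- The triples of sets over which independence models range. -/
structure Admissible {V : Type*} (X Y Z : Set V) : Prop where
  left_nonempty : X.Nonempty
  right_nonempty : Y.Nonempty
  disj_left_right : Disjoint X Y
  disj_left_cond : Disjoint X Z
  disj_right_cond : Disjoint Y Z

/-- The independence model that m-separation assigns to `G`. -/
def MixedGraph.indepModel {V : Type*} (G : MixedGraph V) : Set (Set V × Set V × Set V) :=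
  {t | Admissible t.1 t.2.1 t.2.2 ∧ G.MSep t.1 t.2.1 t.2.2}

/-- Markov equivalence. -/
def MarkovEquiv {V : Type*} (G H : MixedGraph V) : Prop := G.indepModel = H.indepModel

/-- The bidirected edges of `G` form the minimum set of bidirected edges for the Markov
equivalence class of `G`: each of them is bidirected in every MVR chain graph of the class. -/
def HasMinimumBidirected {V : Type*} (G : MixedGraph V) : Prop :=
  ∀ K : MixedGraph V, K.IsMVRCG → MarkovEquiv G K → G.bidirEdges ⊆ K.bidirEdges

/-! ### Distributions -/

section Distribution

variable {V : Type*} {E : V → Type*} [mE : ∀ v, MeasurableSpace (E v)]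

/-- The σ-algebra generated by the variables in `A`. -/
@[reducible] def coordAlgebra (E : V → Type*) [mE : ∀ v, MeasurableSpace (E v)] (A : Set V) :
    MeasurableSpace (∀ v, E v) :=
  ⨆ v ∈ A, (mE v).comap (fun w => w v)

lemma coordAlgebra_le (A : Set V) : coordAlgebra E A ≤ MeasurableSpace.pi :=
  iSup₂_le fun v _ => le_iSup (fun v => (mE v).comap (fun w : ∀ v, E v => w v)) v

/-- Conditional independence, under the joint distribution `p`, of the variables in `A` and the
variables in `B` given the variables in `S`. -/
def CI [Fintype V] [∀ v, StandardBorelSpace (E v)] (p : Measure (∀ v, E v))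
    [IsProbabilityMeasure p] (A B S : Set V) : Prop :=
  CondIndep (coordAlgebra E S) (coordAlgebra E A) (coordAlgebra E B) (coordAlgebra_le S) p

/-- `p` is faithful to `G`: the conditional independences in `p` are exactly the m-separations
in `G`. -/
def Faithful [Fintype V] [∀ v, StandardBorelSpace (E v)] (p : Measure (∀ v, E v))
    [IsProbabilityMeasure p] (G : MixedGraph V) : Prop :=
  ∀ X Y Z : Set V, Admissible X Y Z → (CI p X Y Z ↔ G.MSep X Y Z)

end Distribution

/-! ### The algorithms

`ci u v S` is the answer to the query whether `u` and `v` are independent given `S`. Each phase is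
a relation between its input and its possible results, which leaves the order in which pairs of
nodes, edges and rules are treated completely free. -/

section Algorithm

variable {V : Type*}

/-- Apply `step` while possible, starting in `x` and halting in `y`. -/
def RunsTo {A : Type*} (step : A → A → Prop) (x y : A) : Prop :=
  Relation.ReflTransGen step x y ∧ ∀ z, ¬ step y z

/-- The two versions of the skeleton recovery. -/
inductive SkeletonVersion where
  | original
  | stable

/-- Level `i` of the skeleton recovery, one edge removal. The sets `S` are taken from the adjacency
sets `a u`. -/
def EdgeRemoval (ci : V → V → Set V → Prop) (i : ℕ) (a : V → Set V) (H K : SimpleGraph V) : Prop :=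
  ∃ u v, H.Adj u v ∧ u ∈ a v ∧ i ≤ (a u \ {v}).ncard ∧
    (∃ S ⊆ a u \ {v}, S.ncard = i ∧ ci u v S) ∧ K = H.deleteEdges {s(u, v)}

/-- Level `i` of the skeleton recovery. The original version uses the adjacency sets of the current
graph, the stable version those at the start of the level. -/
def SkeletonLevel (ci : V → V → Set V → Prop) (i : ℕ) :
    SkeletonVersion → SimpleGraph V → SimpleGraph V → Prop
  | .original, H, K => RunsTo (fun L M => EdgeRemoval ci i L.neighborSet L M) H K
  | .stable, H, K => RunsTo (fun L M => EdgeRemoval ci i H.neighborSet L M) H K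

/-- Possible graphs after the levels `0, …, n - 1`, starting from the complete graph. -/
def SkeletonUpTo (ci : V → V → Set V → Prop) (ver : SkeletonVersion) : ℕ → SimpleGraph V → Prop
  | 0, H => H = ⊤
  | n + 1, H => ∃ K, SkeletonUpTo ci ver n K ∧ SkeletonLevel ci n ver K H

/-- Possible results of the skeleton recovery (levels `0, …, |V| - 2`). -/
def SkeletonResult [Fintype V] (ci : V → V → Set V → Prop) (ver : SkeletonVersion)
    (H : SimpleGraph V) : Prop :=
  SkeletonUpTo ci ver (Fintype.card V - 1) H

/-- `(u, w, v)` is an unshielded triple. -/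
def Unshielded (H : SimpleGraph V) (u w v : V) : Prop :=
  H.Adj u w ∧ H.Adj w v ∧ u ≠ v ∧ ¬ H.Adj u v

/-- The separating sets for `u` and `v` among the subsets of the adjacency set of `u` and among
those of the adjacency set of `v`. -/
def sepSets (ci : V → V → Set V → Prop) (H : SimpleGraph V) (u v : V) : Set (Set V) :=
  {S | (S ⊆ H.neighborSet u ∨ S ⊆ H.neighborSet v) ∧ ci u v S}

/-- The percentage of the sets in `F` that contain `w`. -/
noncomputable def percentage (F : Set (Set V)) (w : V) : ℝ :=
  100 * ({S ∈ F | w ∈ S}.ncard : ℝ) / (F.ncard : ℝ)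

/-- How unshielded triples are labelled: conservatively, or by majority with thresholds `α`, `β`
in percent. -/
inductive TripleRule where
  | cpc
  | mpc (α β : ℝ)

/-- The conditions `0 ≤ α ≤ β ≤ 100` on the thresholds. -/
def TripleRule.Valid : TripleRule → Prop
  | .cpc => True
  | .mpc α β => 0 ≤ α ∧ α ≤ β ∧ β ≤ 100

/-- Given the separating sets `F` that were found, is a triple with middle node `w` labelled as
unambiguous? -/
def TripleRule.Accepts (F : Set (Set V)) (w : V) : TripleRule → Prop
  | .cpc => F.Nonempty ∧ ((∀ S ∈ F, w ∈ S) ∨ ∀ S ∈ F, w ∉ S)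
  | .mpc α β => F.Nonempty ∧ (percentage F w ≤ α ∨ β ≤ percentage F w)

/-- Given the separating sets `F` that were found, is an unambiguous triple with middle node `w`
oriented as a v-structure? -/
def TripleRule.Orients (F : Set (Set V)) (w : V) : TripleRule → Prop
  | .cpc => ∀ S ∈ F, w ∉ S
  | .mpc α _ => percentage F w < α ∨ ∀ S ∈ F, w ∉ S

variable (ci : V → V → Set V → Prop) (rule : TripleRule) (H : SimpleGraph V)

/-- `(u, w, v)` is an unshielded triple that is labelled as unambiguous. -/
def Unambiguous (u w v : V) : Prop := Unshielded H u w v ∧ rule.Accepts (sepSets ci H u v) w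

/-- The unshielded triples that are labelled, and marked in the output, as ambiguous. -/
def ambiguousTriples : Set (V × V × V) :=
  {t | Unshielded H t.1 t.2.1 t.2.2 ∧ ¬ Unambiguous ci rule H t.1 t.2.1 t.2.2}

/-- The unambiguous triple `(u, w, v)` is to be oriented as a v-structure. -/
def VStructure (u w v : V) : Prop :=
  Unambiguous ci rule H u w v ∧ rule.Orients (sepSets ci H u v) w

/-- The unambiguous triple `(u, w, v)` is not to be oriented as a v-structure. -/
def NonVStructure (u w v : V) : Prop :=
  Unambiguous ci rule H u w v ∧ ¬ rule.Orients (sepSets ci H u v) w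

/-- The result of the v-structure recovery: the skeleton, with an arrowhead at `w` on the edges
`u — w` and `w — v` for each triple `(u, w, v)` that is to be oriented as a v-structure. -/
def vStructureGraph : MixedGraph V where
  skel := H
  head u w := ∃ v, VStructure ci rule H u w v ∨ VStructure ci rule H v w u
  adj_of_head := by
    rintro u w ⟨v, h | h⟩
    · exact h.1.1.1
    · exact h.1.1.2.1.symm

/-- The orientation rules. `RuleFires ci rule H M x y` says that one of them puts a new arrowhead
at `y` on the edge between `x` and `y` of `M`. In the comments `*` stands for an arbitrary mark. -/
inductive RuleFires (M : MixedGraph V) : V → V → Prop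
  /-- If `a *→ b — c` is an unambiguous unshielded triple which is not a v-structure, orient
  `b → c`. -/
  | r1 (a b c : V) : M.head a b → M.Undir b c → NonVStructure ci rule H a b c → RuleFires M b c
  /-- If `a *→ b *→ c` and `a`, `c` are adjacent, put an arrowhead at `c`. -/
  | r2 (a b c : V) : M.head a b → M.head b c → M.skel.Adj a c → ¬ M.head a c → RuleFires M a c
  /-- If `c *→ b ←* d`, the node `a` is adjacent to `b`, `c` and `d`, and `(c, a, d)` is an
  unambiguous unshielded triple which is not a v-structure, put an arrowhead at `b` on the edge
  between `a` and `b`. -/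
  | r3 (a b c d : V) : M.head c b → M.head d b → NonVStructure ci rule H c a d →
      M.skel.Adj a b → ¬ M.head a b → RuleFires M a b

/-- One application of an orientation rule. -/
def RuleStep (M N : MixedGraph V) : Prop :=
  ∃ x y, RuleFires ci rule H M x y ∧ N.skel = M.skel ∧
    ∀ u v, N.head u v ↔ M.head u v ∨ (u = x ∧ v = y)

/-- The subgraph that contains all nodes and the undirected edges. -/
def MixedGraph.undirectedPart (M : MixedGraph V) : SimpleGraph V where
  Adj := M.Undir
  symm := ⟨fun _ _ h => ⟨h.1.symm, h.2.2, h.2.1⟩⟩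
  loopless := ⟨fun _ h => h.1.ne rfl⟩

/-- The maximal cliques of a graph. -/
abbrev MaxClique (U : SimpleGraph V) : Type _ := {C : Set V // Maximal U.IsClique C}

/-- `T` is a junction tree of `U`: a tree on the maximal cliques with the running intersection
property (cliques of different components may be linked, with empty separators). -/
structure IsJunctionTree (U : SimpleGraph V) (T : SimpleGraph (MaxClique U)) : Prop where
  isTree : T.IsTree
  running : ∀ (C D : MaxClique U) (q : T.Walk C D), q.IsPath →
    ∀ B ∈ q.support, C.1 ∩ D.1 ⊆ B.1

/-- `C` is the first clique, in the order given by `rank`, that contains the node `x`. -/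
def IsFirstClique {U : SimpleGraph V} (rank : MaxClique U → ℕ) (x : V) (C : MaxClique U) : Prop :=
  x ∈ C.1 ∧ ∀ D : MaxClique U, x ∈ D.1 → rank C ≤ rank D

/-- The total order of the nodes given by `ord` comes from a junction tree of `U`: the cliques are
ordered totally such that cliques closer to the root of the tree come first, and the nodes
according to the first clique that contains them. -/
def IsJunctionOrder (U : SimpleGraph V) (ord : V → ℕ) : Prop :=
  Function.Injective ord ∧
  ∃ (T : SimpleGraph (MaxClique U)) (root : MaxClique U) (rank : MaxClique U → ℕ),
    IsJunctionTree U T ∧ Function.Injective rank ∧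
    (∀ C D, T.dist root C < T.dist root D → rank C < rank D) ∧
    ∀ x y C D, IsFirstClique rank x C → IsFirstClique rank y D → rank C < rank D → ord x < ord y

/-- Orient the undirected edges of `M` according to the order of the nodes. -/
def MixedGraph.orientUndirected (M : MixedGraph V) (ord : V → ℕ) : MixedGraph V where
  skel := M.skel
  head u v := M.head u v ∨ (M.Undir u v ∧ ord u < ord v)
  adj_of_head := by
    rintro u v (h | h)
    · exact M.adj_of_head h
    · exact h.1.1

/-- The CPC-like (`rule = .cpc`) or MPC-like (`rule = .mpc α β`) algorithm, in its original or
stable version, can output the graph `N` with the triples in `amb` marked as ambiguous. -/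
def IsOutput [Fintype V] (ver : SkeletonVersion) (N : MixedGraph V) (amb : Set (V × V × V)) :
    Prop :=
  ∃ (H : SimpleGraph V) (M : MixedGraph V) (ord : V → ℕ),
    SkeletonResult ci ver H ∧
    RunsTo (RuleStep ci rule H) (vStructureGraph ci rule H) M ∧
    IsJunctionOrder M.undirectedPart ord ∧
    N = M.orientUndirected ord ∧ amb = ambiguousTriples ci rule H

end Algorithm

end MVR

/-! ### Partially directed cycles and closed walks along arrowheads -/

namespace MVR

namespace MixedGraph

variable {V : Type*} {G K : MixedGraph V}

/-! An MVR chain graph is a mixed graph in which every edge has an arrowhead and in which an edge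
that closes a walk along arrowheads is bidirected (`SemiAcyclic`). All arguments use this form,
since walks are easier to handle than cycles.

Nonadjacent `u`, `v` are m-separated by the parents of `u` or by those of `v`
(`SemiAcyclic.mSep_parents_or`). The skeleton search never deletes an edge of `G`, so these parents
stay in the adjacency sets, and it ends with exactly the skeleton of `G`. The middle vertex of an
unshielded triple lies in no separating set if it is a collider and in every one otherwise. Hence
all triples are unambiguous, the percentages are 0 or 100, and CPC and MPC find the same
v-structures.

Markov equivalence amounts to having the same skeleton and the same unshielded colliders
(`SamePattern`). The hard direction is `SamePattern.mSep`: among the m-connecting walks of least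
length in `G`, one whose vertices have least total distance to the conditioning set is also
m-connecting in `K`. Its colliders are unshielded; its shielded noncolliders and the descents from
its colliders are controlled by a discriminating path argument (`Shortest.scan`).

The rules place only arrowheads that every equivalent graph has (`head_of_rules`). At a fixed point,
an arrowhead at one end of an undirected edge is matched by one at the other end, from the same
vertex (`IsEssential.head_undir`). Thus undirected components behave like single vertices towards
the rest, and orienting them separately creates no partially directed cycle
(`IsEssential.semiAcyclic_orient`). The undirected part is chordal, since a chordless cycle would be
a directed cycle in `G` or would contain an unshielded collider. So a junction tree exists, and its
node orders make the earlier neighbours of each vertex a clique, which rules out new unshielded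
colliders. An undirected edge receives one arrowhead only, so the bidirected edges of the output
were forced by the rules and occur in the whole class. -/

/-- The combinatorial core of MVR chain graphs: every edge has an arrowhead, and every edge which
closes a walk along arrowheads is bidirected. -/
structure SemiAcyclic (G : MixedGraph V) : Prop where
  total : ∀ {a b : V}, G.skel.Adj a b → G.head a b ∨ G.head b a
  closes : ∀ {a b : V}, Relation.ReflTransGen G.head a b → G.head b a → G.head a b

lemma head_irrefl (a : V) : ¬ G.head a a := fun h => (G.adj_of_head h).ne rfl

lemma exists_seq_of_reflTransGen {α : Type*} {r : α → α → Prop} {a b : α}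
    (h : Relation.ReflTransGen r a b) :
    ∃ (n : ℕ) (c : ℕ → α), c 0 = a ∧ c n = b ∧ ∀ i < n, r (c i) (c (i + 1)) := by
  induction h with
  | refl => exact ⟨0, fun _ => a, rfl, rfl, by simp⟩
  | @tail x y _ hxy ih =>
    obtain ⟨n, c, h0, hn, hc⟩ := ih
    refine ⟨n + 1, fun t => if t ≤ n then c t else y, by simp [h0], by simp, fun i hi => ?_⟩
    rcases Nat.lt_or_ge i n with h | h
    · have h1 : i ≤ n := h.le
      have h2 : i + 1 ≤ n := h
      simpa [h1, h2] using hc i h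
    · have : i = n := by omega
      subst this
      simpa [hn] using hxy

lemma reflTransGen_of_seq {α : Type*} {r : α → α → Prop} {n : ℕ} {c : ℕ → α}
    (hc : ∀ i < n, r (c i) (c (i + 1))) {i k : ℕ} (hik : i ≤ k) (hk : k ≤ n) :
    Relation.ReflTransGen r (c i) (c k) := by
  induction k, hik using Nat.le_induction with
  | base => exact .refl
  | succ k _ ih => exact (ih (by omega)).tail (hc k (by omega))

/-- A shortest sequence of steps visits every point at most once. -/
lemma exists_injOn_seq_of_reflTransGen {α : Type*} {r : α → α → Prop} {a b : α}
    (h : Relation.ReflTransGen r a b) :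
    ∃ (n : ℕ) (c : ℕ → α), c 0 = a ∧ c n = b ∧ (∀ i < n, r (c i) (c (i + 1))) ∧
      Set.InjOn c (Set.Iic n) := by
  classical
  have hex : ∃ n : ℕ, ∃ c : ℕ → α, c 0 = a ∧ c n = b ∧ ∀ i < n, r (c i) (c (i + 1)) :=
    exists_seq_of_reflTransGen h
  obtain ⟨c, h0, hn, hc⟩ := Nat.find_spec hex
  set n := Nat.find hex
  have key : ∀ i j, i < j → j ≤ n → c i ≠ c j := by
    intro i j hij hj he
    have hlt : n - (j - i) < Nat.find hex := by omega
    refine Nat.find_min hex hlt ⟨fun t => if t ≤ i then c t else c (t + (j - i)), by simp [h0],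
      ?_, fun t ht => ?_⟩
    · by_cases h1 : n - (j - i) ≤ i
      · have h2 : n = j := by omega
        have h3 : n - (j - i) = i := by omega
        simp only [h3, le_refl, if_true]
        rw [he, ← h2, hn]
      · simp only [h1, if_false]
        rw [show n - (j - i) + (j - i) = n by omega, hn]
    · rcases lt_trichotomy t i with h1 | h1 | h1
      · simp only [h1.le, if_true, show t + 1 ≤ i from h1]
        exact hc t (by omega)
      · subst h1
        simp only [le_refl, if_true, show ¬ (t + 1 ≤ t) by omega, if_false]
        rw [he, show t + 1 + (j - t) = j + 1 by omega]
        exact hc j (by omega)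
      · simp only [show ¬ t ≤ i by omega, show ¬ (t + 1 ≤ i) by omega, if_false]
        rw [show t + 1 + (j - i) = t + (j - i) + 1 by omega]
        exact hc _ (by omega)
  refine ⟨n, c, h0, hn, hc, fun i hi j hj he => ?_⟩
  rcases lt_trichotomy i j with h1 | h1 | h1
  · exact (key i j h1 hj he).elim
  · exact h1
  · exact (key j i h1 hi he.symm).elim

/-- If the closing edge were directed, a shortest walk along arrowheads, which repeats no vertex,
would form a partially directed cycle with it. -/
lemma IsMVRCG.semiAcyclic (hG : G.IsMVRCG) : G.SemiAcyclic where
  total {a b} h := by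
    by_contra hn
    push Not at hn
    exact hG.no_undirected a b ⟨h, hn.1, hn.2⟩
  closes {a b} hab hba := by
    by_contra hn
    refine hG.no_pdc ?_
    obtain ⟨n, c, h0, hcn, hc, hinj⟩ := exists_injOn_seq_of_reflTransGen hab
    -- Length 0 would make the closing edge a loop, and length 1 would be the missing arrowhead
    -- itself.
    have hn2 : 2 ≤ n := by
      rcases n with _ | _ | n
      · rw [← h0, ← hcn] at hba
        exact (head_irrefl _ hba).elim
      · have := hc 0 (by omega)
        rw [h0] at this
        simp only [zero_add] at hcn this
        rw [hcn] at this
        exact (hn this).elim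
      · omega
    refine ⟨n + 1, fun t => if t ≤ n then c t else a, by omega, ?_, by simp [h0], ?_, n, by omega,
      ?_⟩
    · intro i hi j hj he
      have hi' : i ≤ n := Nat.lt_succ_iff.1 hi
      have hj' : j ≤ n := Nat.lt_succ_iff.1 hj
      simp only [hi', hj', if_true] at he
      exact hinj hi' hj' he
    · intro i hi
      rcases Nat.lt_or_ge i n with h | h
      · simp only [h.le, if_true, show i + 1 ≤ n from h]
        by_cases hh : G.head (c (i + 1)) (c i)
        · exact Or.inr ⟨hc i h, hh⟩
        · exact Or.inl ⟨hc i h, hh⟩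
      · have : i = n := by omega
        subst this
        simp only [le_refl, if_true, show ¬ (i + 1 ≤ i) by omega, if_false, hcn]
        exact Or.inl ⟨hba, hn⟩
    · simp only [le_refl, if_true, show ¬ (n + 1 ≤ n) by omega, if_false, hcn]
      exact ⟨hba, hn⟩

lemma SemiAcyclic.isMVRCG (hG : G.SemiAcyclic) : G.IsMVRCG where
  no_undirected u v h := by
    rcases hG.total h.1 with h1 | h1
    · exact h.2.1 h1
    · exact h.2.2 h1
  no_pdc := by
    rintro ⟨n, c, -, -, hn, hc, j, hj, hd⟩
    have hc' : ∀ i < n, G.head (c i) (c (i + 1)) := fun i hi => (hc i hi).elim (·.1) (·.1)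
    have h1 := reflTransGen_of_seq hc' (show j + 1 ≤ n from hj) le_rfl
    have h2 := reflTransGen_of_seq hc' (Nat.zero_le j) hj.le
    rw [hn] at h1
    exact hd.2 (hG.closes (h1.trans h2) hd.1)

namespace SemiAcyclic

lemma head_trans (hG : G.SemiAcyclic) {a b c : V} (hab : G.head a b) (hbc : G.head b c)
    (hac : G.skel.Adj a c) : G.head a c := by
  rcases hG.total hac with h | h
  · exact h
  · exact hG.closes (.tail (.single hab) hbc) h

lemma dir_head_trans (hG : G.SemiAcyclic) {a b c : V} (hab : G.Dir a b) (hbc : G.head b c)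
    (hac : G.skel.Adj a c) : G.Dir a c :=
  ⟨hG.head_trans hab.1 hbc hac, fun h => hab.2 (hG.head_trans hbc h (G.adj_of_head hab.1).symm)⟩

lemma head_dir_trans (hG : G.SemiAcyclic) {a b c : V} (hab : G.head a b) (hbc : G.Dir b c)
    (hac : G.skel.Adj a c) : G.Dir a c :=
  ⟨hG.head_trans hab hbc.1 hac, fun h => hbc.2 (hG.head_trans h hab (G.adj_of_head hbc.1).symm)⟩

lemma dir_of_not_head (hG : G.SemiAcyclic) {a b : V} (hab : G.skel.Adj a b) (h : ¬ G.head b a) :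
    G.Dir a b := ⟨(hG.total hab).resolve_right h, h⟩

lemma not_dir_of_reach (hG : G.SemiAcyclic) {a b : V} (h : Relation.ReflTransGen G.head a b) :
    ¬ G.Dir b a := fun hd => hd.2 (hG.closes h hd.1)

end SemiAcyclic

lemma reach_of_dir {a b : V} (h : Relation.ReflTransGen G.Dir a b) :
    Relation.ReflTransGen G.head a b :=
  Relation.ReflTransGen.mono (fun _ _ h => h.1) _ _ h

lemma mem_An_of_mem {Z : Set V} {a : V} (h : a ∈ Z) : a ∈ G.An Z := ⟨a, h, .refl⟩

lemma mem_An_of_dir {Z : Set V} {a b : V} (h : G.Dir a b) (hb : b ∈ G.An Z) : a ∈ G.An Z := by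
  obtain ⟨z, hz, hbz⟩ := hb
  exact ⟨z, hz, .head h hbz⟩

lemma mem_An_of_reach {Z : Set V} {a b : V} (h : Relation.ReflTransGen G.Dir a b)
    (hb : b ∈ G.An Z) : a ∈ G.An Z := by
  obtain ⟨z, hz, hbz⟩ := hb
  exact ⟨z, hz, h.trans hbz⟩

/-! ### m-connecting sequences -/

/-- The condition that m-connection imposes on three consecutive vertices of a chain. -/
def Open (G : MixedGraph V) (Z : Set V) (x y z : V) : Prop :=
  ((G.head x y ∧ G.head z y) → y ∈ G.An Z) ∧ (¬ (G.head x y ∧ G.head z y) → y ∉ Z)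

lemma Open.symm {Z : Set V} {x y z : V} (h : G.Open Z x y z) : G.Open Z z y x :=
  ⟨fun h' => h.1 h'.symm, fun h' => h.2 fun h'' => h' h''.symm⟩

lemma Open.congr_left {Z : Set V} {x x' y z : V} (h : G.Open Z x y z)
    (hx : G.head x y ↔ G.head x' y) : G.Open Z x' y z := by
  unfold Open at h ⊢
  rwa [← hx]

/-- `p 0, …, p n` is an m-connecting walk given `Z`. -/
structure Conn (G : MixedGraph V) (Z : Set V) (n : ℕ) (p : ℕ → V) : Prop where
  adj : ∀ i < n, G.skel.Adj (p i) (p (i + 1))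
  left : p 0 ∉ Z
  right : p n ∉ Z
  opened : ∀ i, i + 2 ≤ n → G.Open Z (p i) (p (i + 1)) (p (i + 2))

lemma exists_walk_of_seq {H : SimpleGraph V} (n : ℕ) (p : ℕ → V)
    (h : ∀ i < n, H.Adj (p i) (p (i + 1))) :
    ∃ q : H.Walk (p 0) (p n), q.length = n ∧ ∀ i ≤ n, q.getVert i = p i := by
  induction n generalizing p with
  | zero => exact ⟨.nil, rfl, by intro i hi; obtain rfl : i = 0 := by omega
                                 simp⟩
  | succ n ih =>
    obtain ⟨q, hq, hv⟩ := ih (fun t => p (t + 1)) (fun i hi => h (i + 1) (by omega))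
    refine ⟨.cons (h 0 (by omega)) q, by simp [hq], fun i hi => ?_⟩
    rcases i with _ | i
    · simp
    · simpa using hv i (by omega)

lemma getVert_infix {H : SimpleGraph V} {a b : V} (q : H.Walk a b) (i : ℕ) (hi : i + 2 ≤ q.length) :
    [q.getVert i, q.getVert (i + 1), q.getVert (i + 2)] <:+: q.support := by
  rw [List.infix_iff_getElem?]
  refine ⟨i, by simp; omega, fun j hj => ?_⟩
  simp only [List.length_cons, List.length_nil, zero_add, Nat.reduceAdd] at hj
  interval_cases j
  · rw [zero_add, ← SimpleGraph.Walk.getVert_eq_support_getElem? q (by omega)]; simp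
  · rw [add_comm, ← SimpleGraph.Walk.getVert_eq_support_getElem? q (by omega)]; simp
  · rw [add_comm, ← SimpleGraph.Walk.getVert_eq_support_getElem? q (by omega)]; simp

lemma exists_of_infix_support {H : SimpleGraph V} {a b : V} (q : H.Walk a b) {x y z : V}
    (h : [x, y, z] <:+: q.support) :
    ∃ i, i + 2 ≤ q.length ∧ q.getVert i = x ∧ q.getVert (i + 1) = y ∧ q.getVert (i + 2) = z := by
  rw [List.infix_iff_getElem?] at h
  obtain ⟨i, hi, h⟩ := h
  simp only [List.length_cons, List.length_nil, SimpleGraph.Walk.length_support] at hi h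
  have h0 := h 0 (by omega)
  have h1 := h 1 (by omega)
  have h2 := h 2 (by omega)
  rw [zero_add, ← SimpleGraph.Walk.getVert_eq_support_getElem? q (by omega)] at h0
  rw [add_comm, ← SimpleGraph.Walk.getVert_eq_support_getElem? q (by omega)] at h1
  rw [add_comm, ← SimpleGraph.Walk.getVert_eq_support_getElem? q (by omega)] at h2
  exact ⟨i, by omega, by simpa using h0, by simpa using h1, by simpa using h2⟩

lemma MConnecting.conn {Z : Set V} {a b : V} {q : G.skel.Walk a b} (h : G.MConnecting Z q) :
    G.Conn Z q.length q.getVert where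
  adj i hi := q.adj_getVert_succ hi
  left := by simpa using h.2.1
  right := by simpa using h.2.2.1
  opened i hi := h.2.2.2 _ _ _ (getVert_infix q i hi)

lemma Conn.exists_mConnecting {Z : Set V} {n : ℕ} {p : ℕ → V} (h : G.Conn Z n p)
    (hinj : Set.InjOn p (Set.Iic n)) : ∃ q : G.skel.Walk (p 0) (p n), G.MConnecting Z q := by
  obtain ⟨q, hq, hv⟩ := exists_walk_of_seq n p h.adj
  refine ⟨q, ?_, h.left, h.right, ?_⟩
  · rw [SimpleGraph.Walk.isPath_iff_injective_get_support]
    intro i j hij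
    have hi := i.2
    have hj := j.2
    simp only [SimpleGraph.Walk.length_support] at hi hj
    simp only [List.get_eq_getElem, SimpleGraph.Walk.support_getElem_eq_getVert] at hij
    rw [hv _ (by omega), hv _ (by omega)] at hij
    exact Fin.ext (hinj (by simp; omega) (by simp; omega) hij)
  · intro x y z hxyz
    obtain ⟨i, hi, rfl, rfl, rfl⟩ := exists_of_infix_support q hxyz
    rw [hv _ (by omega), hv _ (by omega), hv _ (by omega)]
    exact h.opened i (by omega)

end MixedGraph

end MVR

namespace MVR

namespace MixedGraph

variable {V : Type*} {G K : MixedGraph V}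

/-! ### Separation of single vertices -/

def parents (G : MixedGraph V) (u : V) : Set V := {x | G.Dir x u}

lemma parents_subset (u : V) : G.parents u ⊆ G.skel.neighborSet u :=
  fun _ h => (G.adj_of_head h.1).symm

lemma MConnecting.reverse {Z : Set V} {a b : V} {q : G.skel.Walk a b} (h : G.MConnecting Z q) :
    G.MConnecting Z q.reverse := by
  refine ⟨h.1.reverse, h.2.2.1, h.2.1, fun x z y hxzy => ?_⟩
  rw [SimpleGraph.Walk.support_reverse, ← List.reverse_infix, List.reverse_reverse] at hxzy
  obtain ⟨h1, h2⟩ := h.2.2.2 y z x (by simpa using hxzy)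
  exact ⟨fun h' => h1 h'.symm, fun h' => h2 fun h'' => h' h''.symm⟩

lemma MSep.symm {X Y Z : Set V} (h : G.MSep X Y Z) : G.MSep Y X Z :=
  fun a ha b hb _ hq => h b hb a ha _ hq.reverse

/-- A connecting chain must leave `u` with an arrowhead at its second vertex, which otherwise is a
noncollider among the parents of `u`. Vertices reached from `u` along arrowheads are not ancestors
of parents of `u`, so no collider can occur, the arrowheads propagate to `v`, and the last edge is
directed into `v`. So `u` reaches `v`; if `v` also reaches `u`, a closed walk contains this directed
edge. -/
lemma SemiAcyclic.mSep_parents (hG : G.SemiAcyclic) {u v : V} (huv : u ≠ v)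
    (hadj : ¬ G.skel.Adj u v)
    (hr : ¬ Relation.ReflTransGen G.head u v ∨ Relation.ReflTransGen G.head v u) :
    G.MSep {u} {v} (G.parents u) := by
  rintro a rfl b rfl q hq
  have hc := hq.conn
  have h0 : q.getVert 0 = a := by simp
  have hn : q.getVert q.length = b := by simp
  generalize q.getVert = p at hc h0 hn
  generalize q.length = n at hc hn
  have hn2 : 2 ≤ n := by
    rcases n with _ | _ | n
    · exact (huv (h0.symm.trans hn)).elim
    · have := hc.adj 0 (by omega)
      rw [h0, zero_add, show p 1 = b from hn] at this
      exact (hadj this).elim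
    · omega
  have hAn : ∀ x ∈ G.An (G.parents a), ¬ Relation.ReflTransGen G.head a x := by
    rintro x ⟨z, hz, hxz⟩ hax
    exact hG.not_dir_of_reach (hax.trans (reach_of_dir hxz)) hz
  have hstep : ∀ t, t + 1 ≤ n → Relation.ReflTransGen G.head a (p t) ∧ G.head (p t) (p (t + 1)) := by
    intro t
    induction t with
    | zero =>
      intro _
      refine ⟨by rw [h0], ?_⟩
      by_contra hh
      have hd := hG.dir_of_not_head (hc.adj 0 (by omega)).symm hh
      refine (hc.opened 0 hn2).2 (fun h => hh h.1) ?_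
      rw [h0] at hd
      exact hd
    | succ t ih =>
      intro ht
      obtain ⟨h1, h2⟩ := ih (by omega)
      have h3 := h1.tail h2
      refine ⟨h3, ?_⟩
      by_contra hh
      exact hAn _ ((hc.opened t ht).1
        ⟨h2, (hG.total (hc.adj (t + 1) (by omega))).resolve_left hh⟩) h3
  obtain ⟨m, rfl⟩ : ∃ m, n = m + 2 := ⟨n - 2, by omega⟩
  obtain ⟨h1, h2⟩ := hstep (m + 1) (by omega)
  have h3 : G.Dir (p (m + 1)) (p (m + 2)) := by
    refine ⟨h2, fun h => hAn _ ((hc.opened m (by omega)).1 ⟨(hstep m (by omega)).2, h⟩) h1⟩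
  rw [hn] at h3
  rcases hr with hr | hr
  · exact hr (h1.tail h3.1)
  · exact hG.not_dir_of_reach (hr.trans h1) h3

/-- If the criterion fails for `u`, then `u` reaches `v`, which is the second alternative of the
criterion for `v`. -/
lemma SemiAcyclic.mSep_parents_or (hG : G.SemiAcyclic) {u v : V} (huv : u ≠ v)
    (hadj : ¬ G.skel.Adj u v) :
    G.MSep {u} {v} (G.parents u) ∨ G.MSep {u} {v} (G.parents v) := by
  by_cases h : ¬ Relation.ReflTransGen G.head u v ∨ Relation.ReflTransGen G.head v u
  · exact Or.inl (hG.mSep_parents huv hadj h)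
  · push Not at h
    exact Or.inr (hG.mSep_parents huv.symm (fun h => hadj h.symm) (Or.inr h.1)).symm

lemma not_mSep_of_adj {u v : V} {S : Set V} (h : G.skel.Adj u v) (hu : u ∉ S) (hv : v ∉ S) :
    ¬ G.MSep {u} {v} S := by
  intro hs
  have hc : G.Conn S 1 (fun t => if t = 0 then u else v) :=
    ⟨by intro i hi; obtain rfl : i = 0 := by omega
        simpa using h, by simpa using hu, by simpa using hv, by intro i hi; omega⟩
  obtain ⟨q, hq⟩ := hc.exists_mConnecting (by
    intro i hi j hj hij
    simp only [Set.mem_Iic] at hi hj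
    interval_cases i <;> interval_cases j <;> simp_all [h.ne, h.ne.symm])
  exact hs _ (by simp) _ (by simp) q hq

lemma not_open_of_mSep {u w v : V} {S : Set V} (h : Unshielded G.skel u w v) (hu : u ∉ S)
    (hv : v ∉ S) (hs : G.MSep {u} {v} S) : ¬ G.Open S u w v := by
  intro ho
  obtain ⟨h1, h2, h3, -⟩ := h
  have hc : G.Conn S 2 (fun t => if t = 0 then u else if t = 1 then w else v) := by
    refine ⟨?_, by simpa using hu, by simpa using hv, ?_⟩
    · intro i hi
      interval_cases i <;> simpa
    · intro i hi
      obtain rfl : i = 0 := by omega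
      simpa using ho
  obtain ⟨q, hq⟩ := hc.exists_mConnecting (by
    intro i hi j hj hij
    simp only [Set.mem_Iic] at hi hj
    have := h1.ne
    have := h2.ne
    interval_cases i <;> interval_cases j <;> simp_all)
  exact hs _ (by simp) _ (by simp) q hq

lemma collider_of_mSep_of_notMem {u w v : V} {S : Set V} (h : Unshielded G.skel u w v) (hu : u ∉ S)
    (hv : v ∉ S) (hs : G.MSep {u} {v} S) (hw : w ∉ S) : G.head u w ∧ G.head v w := by
  by_contra hc
  exact not_open_of_mSep h hu hv hs ⟨fun h' => (hc h').elim, fun _ => hw⟩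

lemma notMem_of_collider_of_mSep {u w v : V} {S : Set V} (h : Unshielded G.skel u w v) (hu : u ∉ S)
    (hv : v ∉ S) (hs : G.MSep {u} {v} S) (hc : G.head u w ∧ G.head v w) : w ∉ S :=
  fun hw => not_open_of_mSep h hu hv hs ⟨fun _ => mem_An_of_mem hw, fun h' => (h' hc).elim⟩

/-! ### The pattern of a graph and its recovery from the separations -/

/-- Two mixed graphs with the same skeleton and the same unshielded colliders. -/
structure SamePattern (G K : MixedGraph V) : Prop where
  skel : G.skel = K.skel
  collider : ∀ {u w v : V}, Unshielded G.skel u w v →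
    ((G.head u w ∧ G.head v w) ↔ (K.head u w ∧ K.head v w))

lemma SamePattern.symm (h : G.SamePattern K) : K.SamePattern G where
  skel := h.skel.symm
  collider hu := (h.collider (h.skel ▸ hu)).symm

lemma SamePattern.trans {L : MixedGraph V} (h : G.SamePattern K) (h' : K.SamePattern L) :
    G.SamePattern L where
  skel := h.skel.trans h'.skel
  collider hu := (h.collider hu).trans (h'.collider (h.skel ▸ hu))

end MixedGraph

lemma admissible_singleton {V : Type*} {u v : V} {S : Set V} (huv : u ≠ v) (hu : u ∉ S)
    (hv : v ∉ S) : Admissible {u} {v} S :=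
  ⟨by simp, by simp, by simpa using huv, by simpa using hu, by simpa using hv⟩

lemma MarkovEquiv.mSep_iff {V : Type*} {G K : MixedGraph V} (h : MarkovEquiv G K) {X Y Z : Set V}
    (ha : Admissible X Y Z) : G.MSep X Y Z ↔ K.MSep X Y Z := by
  have : (X, Y, Z) ∈ G.indepModel ↔ (X, Y, Z) ∈ K.indepModel := by rw [h]
  simpa [MixedGraph.indepModel, ha] using this

-- Adjacency means that no set separates, and an unshielded triple is a collider exactly if its
-- middle vertex is missing from some (equivalently, any) separating set. Both are properties of the
-- independence model.
open MixedGraph in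
lemma MarkovEquiv.samePattern {V : Type*} {G K : MixedGraph V} (h : MarkovEquiv G K)
    (hG : G.SemiAcyclic) (hK : K.SemiAcyclic) : G.SamePattern K := by
  have key : ∀ {G K : MixedGraph V}, MarkovEquiv G K → K.SemiAcyclic → ∀ {u v : V},
      G.skel.Adj u v → K.skel.Adj u v := by
    intro G K h hK u v huv
    by_contra hn
    rcases hK.mSep_parents_or huv.ne hn with hs | hs
    · have hu : u ∉ K.parents u := fun h => (K.adj_of_head h.1).ne rfl
      have hv : v ∉ K.parents u := fun h => hn (K.adj_of_head h.1).symm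
      exact not_mSep_of_adj huv hu hv ((h.mSep_iff (admissible_singleton huv.ne hu hv)).2 hs)
    · have hu : u ∉ K.parents v := fun h => hn (K.adj_of_head h.1)
      have hv : v ∉ K.parents v := fun h => (K.adj_of_head h.1).ne rfl
      exact not_mSep_of_adj huv hu hv ((h.mSep_iff (admissible_singleton huv.ne hu hv)).2 hs)
  have hskel : G.skel = K.skel := by
    ext u v
    exact ⟨key h hK, key h.symm hG⟩
  refine ⟨hskel, fun {u w v} hu => ?_⟩
  have hu' : Unshielded K.skel u w v := hskel ▸ hu
  obtain ⟨S, hus, hvs, hs⟩ : ∃ S, u ∉ S ∧ v ∉ S ∧ G.MSep {u} {v} S := by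
    have hn := hu.2.2.2
    rcases hG.mSep_parents_or hu.2.2.1 hn with hs | hs
    · exact ⟨_, fun h => (G.adj_of_head h.1).ne rfl, fun h => hn (G.adj_of_head h.1).symm, hs⟩
    · exact ⟨_, fun h => hn (G.adj_of_head h.1), fun h => (G.adj_of_head h.1).ne rfl, hs⟩
  have hs' := (h.mSep_iff (admissible_singleton hu.2.2.1 hus hvs)).1 hs
  exact ⟨fun hc => collider_of_mSep_of_notMem hu' hus hvs hs'
      (notMem_of_collider_of_mSep hu hus hvs hs hc),
    fun hc => collider_of_mSep_of_notMem hu hus hvs hs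
      (notMem_of_collider_of_mSep hu' hus hvs hs' hc)⟩

end MVR

namespace MVR

namespace MixedGraph

variable {V : Type*} {G K : MixedGraph V} {Z : Set V}

/-! ### Gluing m-connecting sequences -/

/-- A walk all of whose inner vertices satisfy the condition for m-connection. -/
structure Seg (G : MixedGraph V) (Z : Set V) (n : ℕ) (p : ℕ → V) : Prop where
  adj : ∀ i < n, G.skel.Adj (p i) (p (i + 1))
  opened : ∀ i, i + 2 ≤ n → G.Open Z (p i) (p (i + 1)) (p (i + 2))

lemma Conn.seg {n : ℕ} {p : ℕ → V} (h : G.Conn Z n p) : G.Seg Z n p := ⟨h.adj, h.opened⟩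

lemma Seg.take {n m : ℕ} {p : ℕ → V} (h : G.Seg Z n p) (hm : m ≤ n) : G.Seg Z m p :=
  ⟨fun i hi => h.adj i (by omega), fun i hi => h.opened i (by omega)⟩

lemma Seg.drop {n : ℕ} {p : ℕ → V} (h : G.Seg Z n p) (k : ℕ) :
    G.Seg Z (n - k) (fun t => p (t + k)) := by
  refine ⟨fun i hi => ?_, fun i hi => ?_⟩
  · have := h.adj (i + k) (by omega)
    rwa [show i + k + 1 = i + 1 + k by omega] at this
  · have := h.opened (i + k) (by omega)
    rwa [show i + k + 1 = i + 1 + k by omega, show i + k + 2 = i + 2 + k by omega] at this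

/-- The shift by `j + 1` leaves room for the joining edge from `p j` to `r 0`. -/
def glueSeq (j : ℕ) (p r : ℕ → V) (t : ℕ) : V := if t ≤ j then p t else r (t - (j + 1))

lemma glueSeq_left {j t : ℕ} (p r : ℕ → V) (h : t ≤ j) : glueSeq j p r t = p t := if_pos h

lemma glueSeq_right {j t : ℕ} (p r : ℕ → V) (s : ℕ) (h : t = j + 1 + s) :
    glueSeq j p r t = r s := by
  rw [glueSeq, if_neg (by omega)]
  congr 1
  omega

lemma Seg.glue {j m : ℕ} {p r : ℕ → V} (hp : G.Seg Z j p) (hr : G.Seg Z m r)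
    (hadj : G.skel.Adj (p j) (r 0)) (h1 : ∀ i, i + 1 = j → G.Open Z (p i) (p j) (r 0))
    (h2 : 0 < m → G.Open Z (p j) (r 0) (r 1)) :
    G.Seg Z (j + 1 + m) (glueSeq j p r) := by
  refine ⟨fun i hi => ?_, fun i hi => ?_⟩
  · rcases lt_trichotomy i j with h | rfl | h
    · rw [glueSeq_left p r h.le, glueSeq_left p r h]
      exact hp.adj i h
    · rw [glueSeq_left p r le_rfl, glueSeq_right p r 0 (by omega)]
      exact hadj
    · obtain ⟨s, rfl⟩ := Nat.exists_eq_add_of_lt h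
      rw [glueSeq_right p r s (by omega), glueSeq_right p r (s + 1) (by omega)]
      exact hr.adj s (by omega)
  · rcases lt_trichotomy i j with h | rfl | h
    · rcases Nat.lt_or_ge (i + 1) j with h' | h'
      · rw [glueSeq_left p r h.le, glueSeq_left p r h, glueSeq_left p r h']
        exact hp.opened i h'
      · obtain rfl : i + 1 = j := by omega
        rw [glueSeq_left p r h.le, glueSeq_left p r le_rfl, glueSeq_right p r 0 (by omega)]
        exact h1 i rfl
    · rw [glueSeq_left p r le_rfl, glueSeq_right p r 0 (by omega),
        glueSeq_right p r 1 (by omega)]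
      exact h2 (by omega)
    · obtain ⟨s, rfl⟩ := Nat.exists_eq_add_of_lt h
      rw [glueSeq_right p r s (by omega), glueSeq_right p r (s + 1) (by omega),
        glueSeq_right p r (s + 2) (by omega)]
      exact hr.opened s (by omega)

lemma Conn.reverse {n : ℕ} {p : ℕ → V} (h : G.Conn Z n p) :
    G.Conn Z n (fun t => p (n - t)) := by
  refine ⟨fun i hi => ?_, by simpa using h.right, by simpa using h.left, fun i hi => ?_⟩
  · have := (h.adj (n - (i + 1)) (by omega)).symm
    rwa [show n - (i + 1) + 1 = n - i by omega] at this
  · have := (h.opened (n - (i + 2)) (by omega)).symm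
    rwa [show n - (i + 2) + 1 = n - (i + 1) by omega,
      show n - (i + 2) + 2 = n - i by omega] at this

/-! ### Shortest m-connecting walks -/

/-- An m-connecting walk with the least possible number of edges between its endpoints. -/
structure Shortest (G : MixedGraph V) (Z : Set V) (n : ℕ) (p : ℕ → V) : Prop where
  conn : G.Conn Z n p
  le : ∀ m q, G.Conn Z m q → q 0 = p 0 → q m = p n → n ≤ m

lemma Shortest.reverse {n : ℕ} {p : ℕ → V} (h : G.Shortest Z n p) :
    G.Shortest Z n (fun t => p (n - t)) :=
  ⟨h.conn.reverse, fun m q hq h0 hm => h.le m _ hq.reverse (by simpa using hm) (by simpa using h0)⟩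

lemma Conn.cut {n : ℕ} {p : ℕ → V} (h : G.Conn Z n p) {j k : ℕ} (hjn : j ≤ n) (hk : k ≤ n)
    (hadj : G.skel.Adj (p j) (p k)) (h1 : ∀ i, i + 1 = j → G.Open Z (p i) (p j) (p k))
    (h2 : k < n → G.Open Z (p j) (p k) (p (k + 1))) :
    ∃ q, G.Conn Z (j + 1 + (n - k)) q ∧ q 0 = p 0 ∧ q (j + 1 + (n - k)) = p n := by
  have hs := (h.seg.take hjn).glue (h.seg.drop k) (by simpa using hadj)
    (by simpa using h1) (fun hlt => by simpa [add_comm] using h2 (by omega))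
  have e0 : glueSeq j p (fun t => p (t + k)) 0 = p 0 := glueSeq_left _ _ (Nat.zero_le j)
  have en : glueSeq j p (fun t => p (t + k)) (j + 1 + (n - k)) = p n := by
    rw [glueSeq_right _ _ (n - k) rfl]
    congr 1
    omega
  exact ⟨_, ⟨hs.adj, by rw [e0]; exact h.left, by rw [en]; exact h.right, hs.opened⟩, e0, en⟩

lemma Shortest.not_cut {n : ℕ} {p : ℕ → V} (h : G.Shortest Z n p) {j k : ℕ} (hjk : j + 1 < k)
    (hk : k ≤ n) (hadj : G.skel.Adj (p j) (p k))
    (h1 : ∀ i, i + 1 = j → G.Open Z (p i) (p j) (p k))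
    (h2 : k < n → G.Open Z (p j) (p k) (p (k + 1))) : False := by
  obtain ⟨q, hq, e0, en⟩ := h.conn.cut (by omega) hk hadj h1 h2
  have := h.le _ q hq e0 en
  omega

/-- Replacing the vertices strictly between `p j` and `p k` by the single vertex `d`. -/
lemma Conn.replace {n : ℕ} {p : ℕ → V} (h : G.Conn Z n p) {j k : ℕ} {d : V} (hjn : j ≤ n)
    (hk : k ≤ n) (hj' : G.skel.Adj (p j) d) (hk' : G.skel.Adj d (p k))
    (h1 : ∀ i, i + 1 = j → G.Open Z (p i) (p j) d) (h2 : G.Open Z (p j) d (p k))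
    (h3 : k < n → G.Open Z d (p k) (p (k + 1))) :
    ∃ q, G.Conn Z (j + 2 + (n - k)) q ∧ q 0 = p 0 ∧ q (j + 2 + (n - k)) = p n ∧
      (k = j + 2 → ∀ t, q t = if t = j + 1 then d else p t) := by
  have hd : G.Seg Z 0 (fun _ => d) := ⟨by simp, by simp⟩
  have hs1 := hd.glue (h.seg.drop k) (by simpa using hk') (by simp)
    (fun hlt => by simpa [add_comm] using h3 (by omega))
  set r := glueSeq 0 (fun _ => d) (fun t => p (t + k))
  have r0 : r 0 = d := glueSeq_left _ _ le_rfl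
  have rs : ∀ s, r (s + 1) = p (s + k) := fun s => glueSeq_right _ _ s (by omega)
  have hs := (h.seg.take hjn).glue hs1 (by simpa [r0] using hj') (by simpa [r0] using h1)
    (fun _ => by simpa [r0, rs 0] using h2)
  have elen : j + 1 + (0 + 1 + (n - k)) = j + 2 + (n - k) := by omega
  rw [elen] at hs
  have e0 : glueSeq j p r 0 = p 0 := glueSeq_left _ _ (Nat.zero_le j)
  have en : glueSeq j p r (j + 2 + (n - k)) = p n := by
    rw [glueSeq_right _ _ (n - k + 1) (by omega), rs]
    congr 1
    omega
  refine ⟨_, ⟨hs.adj, by rw [e0]; exact h.left, by rw [en]; exact h.right, hs.opened⟩, e0, en, ?_⟩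
  rintro rfl t
  rcases lt_trichotomy t (j + 1) with ht | rfl | ht
  · rw [if_neg ht.ne, glueSeq_left _ _ (by omega)]
  · rw [if_pos rfl, glueSeq_right _ _ 0 rfl, r0]
  · rw [if_neg ht.ne', glueSeq_right _ _ (t - (j + 2) + 1) (by omega), rs]
    congr 1
    omega

/-- A connecting walk that starts along a directed edge stays directed until its first collider, and
that collider is in `An Z`. -/
lemma Conn.mem_An_or_reach {n : ℕ} {p : ℕ → V} (hG : G.SemiAcyclic) (h : G.Conn Z n p) {i : ℕ}
    (hd : G.Dir (p i) (p (i + 1))) (t : ℕ) (ht : i + t + 1 ≤ n) :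
    p i ∈ G.An Z ∨
      (Relation.ReflTransGen G.Dir (p i) (p (i + t)) ∧ G.Dir (p (i + t)) (p (i + t + 1))) := by
  induction t with
  | zero => exact Or.inr ⟨.refl, hd⟩
  | succ t ih =>
    rcases ih (by omega) with h1 | ⟨h1, h2⟩
    · exact Or.inl h1
    · have h3 := h1.tail h2
      by_cases hh : G.head (p (i + t + 2)) (p (i + t + 1))
      · exact Or.inl (mem_An_of_reach h3 ((h.opened (i + t) (by omega)).1 ⟨h2.1, hh⟩))
      · exact Or.inr ⟨h3, hG.dir_of_not_head (h.adj (i + t + 1) (by omega)) hh⟩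

/-- A shortest m-connecting walk is a path. -/
lemma Shortest.injOn {n : ℕ} {p : ℕ → V} (h : G.Shortest Z n p) (hG : G.SemiAcyclic) :
    Set.InjOn p (Set.Iic n) := by
  have key : ∀ i j, i < j → j ≤ n → p i ≠ p j := by
    intro i j hij hj he
    rcases hj.eq_or_lt with rfl | hjn
    · have hs := h.conn.seg.take hij.le
      have := h.le i p ⟨hs.adj, h.conn.left, by rw [he]; exact h.conn.right, hs.opened⟩ rfl he
      omega
    -- Excise the closed part between the two visits. The vertex where the ends now meet must be
    -- shown open.
    · refine absurd (h.conn.cut (j := i) (k := j + 1) (by omega) (by omega)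
        (he ▸ h.conn.adj j hjn) ?_ ?_) ?_
      · rintro m rfl
        have o1 := h.conn.opened m (by omega)
        obtain ⟨l, rfl⟩ : ∃ l, j = l + 1 := ⟨j - 1, by omega⟩
        have o2 := h.conn.opened l (by omega)
        rw [← he] at o2
        refine ⟨fun hc => ?_, fun hc hmem => ?_⟩
        -- The closed part leaves and re-enters the vertex through tails there. Followed from its
        -- start, it meets a collider in `An Z` or stays directed and returns with an arrowhead.
        · by_contra hA
          have n1 : ¬ G.head (p (m + 2)) (p (m + 1)) := fun h' => hA (o1.1 ⟨hc.1, h'⟩)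
          have n2 : ¬ G.head (p l) (p (m + 1)) := fun h' => hA (o2.1 ⟨h', hc.2⟩)
          have d1 := hG.dir_of_not_head (h.conn.adj (m + 1) (by omega)) n1
          rcases h.conn.mem_An_or_reach hG d1 (l - (m + 1)) (by omega) with h' | ⟨-, h'⟩
          · exact hA h'
          · rw [show m + 1 + (l - (m + 1)) = l by omega, ← he] at h'
            exact n2 h'.1
        · refine hc ⟨?_, ?_⟩
          · by_contra h'
            exact o1.2 (fun h'' => h' h''.1) hmem
          · by_contra h'
            exact o2.2 (fun h'' => h' h''.2) hmem
      · intro hlt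
        rw [he]
        exact h.conn.opened j (by omega)
      · rintro ⟨q, hq, e0, en⟩
        have := h.le _ q hq e0 en
        omega
  intro i hi j hj he
  rcases lt_trichotomy i j with h1 | h1 | h1
  · exact (key i j h1 hj he).elim
  · exact h1
  · exact (key j i h1 hi he.symm).elim

/-- This allows a shielded collider `y` to be bypassed. If `x` becomes a collider, it was one before
or is a parent of `y`. If a collider `x` in `Z` ceased to be one, then `x → z` and hence `x → y`,
against the arrowhead at `x`. -/
lemma Open.of_shielded_collider (hG : G.SemiAcyclic) {w x y z : V} (h : G.Open Z w x y)
    (hy : y ∈ G.An Z) (hxy : G.head x y) (hzy : G.head z y) (hxz : G.skel.Adj x z) :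
    G.Open Z w x z := by
  refine ⟨fun hc => ?_, fun hc hx => ?_⟩
  · by_cases hyx : G.head y x
    · exact h.1 ⟨hc.1, hyx⟩
    · exact mem_An_of_dir ⟨hxy, hyx⟩ hy
  · have hc' : G.head w x ∧ G.head y x := by
      by_contra h'
      exact h.2 h' hx
    have hzx : ¬ G.head z x := fun h' => hc ⟨hc'.1, h'⟩
    exact (hG.dir_head_trans (hG.dir_of_not_head hxz hzx) hzy (G.adj_of_head hxy)).2 hc'.2

lemma Shortest.collider_unshielded {n : ℕ} {p : ℕ → V} (h : G.Shortest Z n p)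
    (hG : G.SemiAcyclic) {i : ℕ} (hi : i + 2 ≤ n) (h1 : G.head (p i) (p (i + 1)))
    (h2 : G.head (p (i + 2)) (p (i + 1))) : Unshielded G.skel (p i) (p (i + 1)) (p (i + 2)) := by
  refine ⟨G.adj_of_head h1, (G.adj_of_head h2).symm, fun he => ?_, fun hadj => ?_⟩
  · have := h.injOn hG (show i ≤ n by omega) (show i + 2 ≤ n from hi) he
    omega
  · have hy := (h.conn.opened i hi).1 ⟨h1, h2⟩
    refine h.not_cut (j := i) (k := i + 2) (by omega) hi hadj ?_ ?_
    · rintro l rfl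
      exact (h.conn.opened l (by omega)).of_shielded_collider hG hy h1 h2 hadj
    · intro hlt
      exact ((h.conn.opened (i + 1) (by omega)).symm.of_shielded_collider hG hy h2 h1
        hadj.symm).symm

/-! ### Transfer to a graph with the same unshielded colliders -/

section Transfer

variable {n : ℕ} {p : ℕ → V}

lemma Shortest.collider_transfer (h : G.Shortest Z n p) (hG : G.SemiAcyclic)
    (hGK : G.SamePattern K) {i : ℕ} (hi : i + 2 ≤ n) (h1 : G.head (p i) (p (i + 1)))
    (h2 : G.head (p (i + 2)) (p (i + 1))) :
    K.head (p i) (p (i + 1)) ∧ K.head (p (i + 2)) (p (i + 1)) :=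
  (hGK.collider (h.collider_unshielded hG hi h1 h2)).1 ⟨h1, h2⟩

/-- The orientation of `p (m + 1) → z` is forced by a discriminating path, or the walk can be
continued from an earlier vertex directly to `z`. -/
lemma Shortest.scan (h : G.Shortest Z n p) (hG : G.SemiAcyclic) (hK : K.SemiAcyclic)
    (hGK : G.SamePattern K) {m : ℕ} {z : V} (hm : m + 1 ≤ n) (hd : G.Dir (p (m + 1)) z)
    (hz : z ≠ p m) (ha : G.skel.Adj (p m) z → G.head (p m) z) :
    (∃ j ≤ m, G.head (p j) z ∧ ∀ i, i + 1 = j → G.Open Z (p i) (p j) z) ∨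
      (K.head (p m) (p (m + 1)) → K.Dir (p (m + 1)) z) := by
  -- Invariant of a leftward scan: `p (j + 1), …, p m` are colliders in `Z` and parents of `z`. The
  -- scan stops when `p j` can be joined to `z` directly, or when it is not adjacent to `z` and the
  -- path is discriminating.
  suffices H : ∀ j ≤ m, (∀ t, j ≤ t → t + 1 ≤ m → G.head (p t) (p (t + 1)) ∧
      G.head (p (t + 2)) (p (t + 1)) ∧ p (t + 1) ∈ Z ∧ G.Dir (p (t + 1)) z) →
      (∃ j ≤ m, G.head (p j) z ∧ ∀ i, i + 1 = j → G.Open Z (p i) (p j) z) ∨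
      (K.head (p m) (p (m + 1)) → K.Dir (p (m + 1)) z) from
    H m le_rfl (fun t h1 h2 => by omega)
  intro j
  induction j using Nat.strong_induction_on with
  | _ j ih =>
  intro hj hcol
  have hne : p j ≠ z := by
    rcases hj.eq_or_lt with rfl | hlt
    · exact hz.symm
    · obtain ⟨c1, -, -, c4⟩ := hcol j le_rfl hlt
      rintro rfl
      exact c4.2 c1
  by_cases hadj : G.skel.Adj (p j) z
  · have hh : G.head (p j) z := by
      rcases hj.eq_or_lt with rfl | hlt
      · exact ha hadj
      · obtain ⟨c1, -, -, c4⟩ := hcol j le_rfl hlt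
        exact hG.head_trans c1 c4.1 hadj
    by_cases hop : ∀ i, i + 1 = j → G.Open Z (p i) (p j) z
    · exact Or.inl ⟨j, hj, hh, hop⟩
    push Not at hop
    obtain ⟨i, rfl, hop⟩ := hop
    refine ih i (by omega) (by omega) fun t ht htm => ?_
    rcases ht.eq_or_lt with rfl | hlt
    swap
    · exact hcol t hlt htm
    have o := h.conn.opened i (by omega)
    -- The direct edge to `z` fails at `p (i + 1)`. A new collider outside `An Z` is impossible,
    -- because its next edge on the walk leads to `Z` or, at the first step of the scan, to a parent
    -- of `z`. So `p (i + 1)` is in `Z`, a collider on the walk and a parent of `z`, which extends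
    -- the invariant.
    by_cases hc : G.head (p i) (p (i + 1)) ∧ G.head z (p (i + 1))
    · have hA : p (i + 1) ∉ G.An Z := fun hA => hop ⟨fun _ => hA, fun h' => (h' hc).elim⟩
      have hn : ¬ G.head (p (i + 2)) (p (i + 1)) := fun h' => hA (o.1 ⟨hc.1, h'⟩)
      have hdir := hG.dir_of_not_head (h.conn.adj (i + 1) (by omega)) hn
      rcases hj.eq_or_lt with rfl | hlt
      · exact ((hG.dir_head_trans hdir hd.1 hadj).2 hc.2).elim
      · exact (hA (mem_An_of_dir hdir (mem_An_of_mem (hcol (i + 1) le_rfl hlt).2.2.1))).elim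
    · have hZ : p (i + 1) ∈ Z := by
        by_contra hZ
        exact hop ⟨fun h' => (hc h').elim, fun _ => hZ⟩
      have hcol' : G.head (p i) (p (i + 1)) ∧ G.head (p (i + 2)) (p (i + 1)) := by
        by_contra h'
        exact o.2 h' hZ
      exact ⟨hcol'.1, hcol'.2, hZ, hh, fun h' => hc ⟨hcol'.1, h'⟩⟩
  -- The unshielded noncollider at `p (j + 1)` forces `p (j + 1) → z` in `K`. The arrowheads that
  -- point back along the transferred colliders carry this direction to `p (m + 1)`.
  · refine Or.inr fun hk => ?_
    have hKc : ∀ t, j ≤ t → t + 1 ≤ m →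
        K.head (p t) (p (t + 1)) ∧ K.head (p (t + 2)) (p (t + 1)) := fun t h1 h2 => by
      obtain ⟨c1, c2, -, -⟩ := hcol t h1 h2
      exact h.collider_transfer hG hGK (by omega) c1 c2
    have hD : ∀ t, j + 1 ≤ t → t ≤ m + 1 → G.Dir (p t) z := by
      intro t h1 h2
      rcases h2.eq_or_lt with rfl | h2
      · exact hd
      · obtain ⟨s, rfl⟩ : ∃ s, t = s + 1 := ⟨t - 1, by omega⟩
        exact (hcol s (by omega) (by omega)).2.2.2
    have hhead : K.head (p j) (p (j + 1)) := by
      rcases hj.eq_or_lt with rfl | hlt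
      · exact hk
      · exact (hKc j le_rfl hlt).1
    have hun : Unshielded G.skel (p j) (p (j + 1)) z :=
      ⟨h.conn.adj j (by omega), G.adj_of_head (hD (j + 1) le_rfl (by omega)).1, hne, hadj⟩
    have hadjK : ∀ t, j + 1 ≤ t → t ≤ m + 1 → K.skel.Adj (p t) z := fun t h1 h2 =>
      hGK.skel ▸ G.adj_of_head (hD t h1 h2).1
    have hall : ∀ t, j + 1 ≤ t → t ≤ m + 1 → K.Dir (p t) z := by
      intro t ht
      induction t, ht using Nat.le_induction with
      | base =>
        intro h2
        refine hK.dir_of_not_head (hadjK _ le_rfl h2) fun h' => ?_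
        exact (hD _ le_rfl h2).2 ((hGK.collider hun).2 ⟨hhead, h'⟩).2
      | succ t ht ih' =>
        intro h2
        obtain ⟨s, rfl⟩ : ∃ s, t = s + 1 := ⟨t - 1, by omega⟩
        exact hK.head_dir_trans (hKc s (by omega) (by omega)).2 (ih' (by omega))
          (hadjK _ (by omega) h2)
    exact hall (m + 1) (by omega) le_rfl

lemma Shortest.scan_right (h : G.Shortest Z n p) (hG : G.SemiAcyclic) (hK : K.SemiAcyclic)
    (hGK : G.SamePattern K) {m : ℕ} {z : V} (hm : m + 1 ≤ n) (hd : G.Dir (p m) z)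
    (hz : z ≠ p (m + 1)) (ha : G.skel.Adj (p (m + 1)) z → G.head (p (m + 1)) z) :
    (∃ k, m + 1 ≤ k ∧ k ≤ n ∧ G.head (p k) z ∧ (k < n → G.Open Z z (p k) (p (k + 1)))) ∨
      (K.head (p (m + 1)) (p m) → K.Dir (p m) z) := by
  have := h.reverse.scan hG hK hGK (m := n - (m + 1)) (z := z) (by omega)
    (by rwa [show n - (n - (m + 1) + 1) = m by omega])
    (by rwa [show n - (n - (m + 1)) = m + 1 by omega])
    (by rwa [show n - (n - (m + 1)) = m + 1 by omega])
  rw [show n - (n - (m + 1) + 1) = m by omega, show n - (n - (m + 1)) = m + 1 by omega] at this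
  rcases this with ⟨j, hj, h1, h2⟩ | h'
  · refine Or.inl ⟨n - j, by omega, by omega, h1, fun hlt => ?_⟩
    have := (h2 (j - 1) (by omega)).symm
    rwa [show n - (j - 1) = n - j + 1 by omega] at this
  · exact Or.inr h'

/-- The scan towards `p (i + 2)` either yields a shortcut, which has an arrowhead at `p (i + 2)` as
the old edge had and so keeps that vertex open, or forces the edge to be directed in `K`. -/
lemma Shortest.noncollider_of_dir (h : G.Shortest Z n p) (hG : G.SemiAcyclic)
    (hK : K.SemiAcyclic) (hGK : G.SamePattern K) {i : ℕ} (hi : i + 2 ≤ n)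
    (hd : G.Dir (p (i + 1)) (p (i + 2))) (hh : G.head (p i) (p (i + 2))) :
    ¬ (K.head (p i) (p (i + 1)) ∧ K.head (p (i + 2)) (p (i + 1))) := by
  rintro ⟨h1, h2⟩
  rcases h.scan hG hK hGK (m := i) (by omega) hd (G.adj_of_head hh).ne.symm (fun _ => hh) with
    ⟨j, hj, hj1, hj2⟩ | h'
  · refine h.not_cut (j := j) (k := i + 2) (by omega) hi (G.adj_of_head hj1) hj2 fun hlt => ?_
    exact (h.conn.opened (i + 1) (by omega)).congr_left (iff_of_true hd.1 hj1)
  · exact (h' h1).2 h2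

lemma Shortest.noncollider_of_dir_left (h : G.Shortest Z n p) (hG : G.SemiAcyclic)
    (hK : K.SemiAcyclic) (hGK : G.SamePattern K) {i : ℕ} (hi : i + 2 ≤ n)
    (hd : G.Dir (p (i + 1)) (p i)) (hh : G.head (p (i + 2)) (p i)) :
    ¬ (K.head (p i) (p (i + 1)) ∧ K.head (p (i + 2)) (p (i + 1))) := by
  have e1 : n - (n - (i + 2) + 1) = i + 1 := by omega
  have e2 : n - (n - (i + 2) + 2) = i := by omega
  have e3 : n - (n - (i + 2)) = i + 2 := by omega
  have := h.reverse.noncollider_of_dir hG hK hGK (i := n - (i + 2)) (by omega)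
    (by rwa [e1, e2]) (by rwa [e2, e3])
  rw [e1, e2, e3] at this
  exact fun h' => this h'.symm

/-- A shielded noncollider has a tail on one of its edges, and that edge can be chosen so that the
shielding edge has an arrowhead at its far end. -/
lemma Shortest.noncollider_transfer (h : G.Shortest Z n p) (hG : G.SemiAcyclic)
    (hK : K.SemiAcyclic) (hGK : G.SamePattern K) {i : ℕ} (hi : i + 2 ≤ n)
    (hn : ¬ (G.head (p i) (p (i + 1)) ∧ G.head (p (i + 2)) (p (i + 1)))) :
    ¬ (K.head (p i) (p (i + 1)) ∧ K.head (p (i + 2)) (p (i + 1))) := by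
  have a1 := h.conn.adj i (by omega)
  have a2 := h.conn.adj (i + 1) (by omega)
  by_cases hadj : G.skel.Adj (p i) (p (i + 2))
  · by_cases hz : G.head (p (i + 2)) (p (i + 1))
    · have hx : ¬ G.head (p i) (p (i + 1)) := fun hx => hn ⟨hx, hz⟩
      have hyx := hG.dir_of_not_head a1.symm hx
      exact h.noncollider_of_dir_left hG hK hGK hi hyx (hG.head_trans hz hyx.1 hadj.symm)
    · have hyz := hG.dir_of_not_head a2 hz
      by_cases hx : G.head (p i) (p (i + 1))
      · exact h.noncollider_of_dir hG hK hGK hi hyz (hG.head_trans hx hyz.1 hadj)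
      · rcases hG.total hadj with h' | h'
        · exact h.noncollider_of_dir hG hK hGK hi hyz h'
        · exact h.noncollider_of_dir_left hG hK hGK hi (hG.dir_of_not_head a1.symm hx) h'
  · have hne : p i ≠ p (i + 2) := fun he => by
      have := h.injOn hG (show i ≤ n by omega) (show i + 2 ≤ n from hi) he
      omega
    exact fun h' => hn ((hGK.collider ⟨a1, a2, hne, hadj⟩).2 h')

end Transfer

/-! ### Distance to the conditioning set -/

/-- Vertices with a directed walk of length `n` to `Z`. -/
def descendsIn (G : MixedGraph V) (Z : Set V) : ℕ → Set V
  | 0 => Z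
  | n + 1 => {v | ∃ d, G.Dir v d ∧ d ∈ G.descendsIn Z n}

lemma mem_An_of_descendsIn {k : ℕ} {v : V} (h : v ∈ G.descendsIn Z k) : v ∈ G.An Z := by
  induction k generalizing v with
  | zero => exact mem_An_of_mem h
  | succ k ih =>
    obtain ⟨d, hd, hdk⟩ := h
    exact mem_An_of_dir hd (ih hdk)

lemma exists_descendsIn {v : V} (h : v ∈ G.An Z) : ∃ k, v ∈ G.descendsIn Z k := by
  obtain ⟨z, hz, hvz⟩ := h
  induction hvz using Relation.ReflTransGen.head_induction_on with
  | refl => exact ⟨0, hz⟩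
  | head h' _ ih =>
    obtain ⟨k, hk⟩ := ih
    exact ⟨k + 1, _, h', hk⟩

/-- The length of a shortest directed walk to `Z`. -/
noncomputable def depth (G : MixedGraph V) (Z : Set V) (v : V) : ℕ :=
  sInf {k | v ∈ G.descendsIn Z k}

lemma mem_descendsIn_depth {v : V} (h : v ∈ G.An Z) : v ∈ G.descendsIn Z (G.depth Z v) :=
  Nat.sInf_mem (s := {k | v ∈ G.descendsIn Z k}) (exists_descendsIn h)

lemma depth_le {v : V} {k : ℕ} (h : v ∈ G.descendsIn Z k) : G.depth Z v ≤ k := Nat.sInf_le h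

lemma depth_le_of_dir {v d : V} (h : G.Dir v d) (hd : d ∈ G.An Z) :
    G.depth Z v ≤ G.depth Z d + 1 :=
  depth_le (k := G.depth Z d + 1) ⟨d, h, mem_descendsIn_depth hd⟩

lemma exists_dir_depth {v : V} (h : v ∈ G.An Z) (hv : v ∉ Z) :
    ∃ d ∈ G.An Z, G.Dir v d ∧ G.depth Z v = G.depth Z d + 1 := by
  have hm := mem_descendsIn_depth h
  rcases hk : G.depth Z v with _ | k
  · rw [hk] at hm
    exact (hv hm).elim
  · rw [hk] at hm
    obtain ⟨d, hd, hdk⟩ := hm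
    have hA := mem_An_of_descendsIn hdk
    refine ⟨d, hA, hd, ?_⟩
    have h1 := depth_le hdk
    have h2 := depth_le_of_dir hd hA
    omega

/-- On a shortest descent `v → d → e` the vertices `v` and `e` are nonadjacent, for `v → e` would be
shorter. So `d` is an unshielded noncollider, and the direction of the first edge in `K` propagates
down to `Z`. -/
lemma mem_An_transfer (hG : G.SemiAcyclic) (hK : K.SemiAcyclic) (hGK : G.SamePattern K) {v d : V}
    (hd : G.Dir v d) (hdA : d ∈ G.An Z) (hdep : G.depth Z v = G.depth Z d + 1)
    (hkd : K.Dir v d) : d ∈ K.An Z := by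
  induction hk : G.depth Z d generalizing v d with
  | zero =>
    have := mem_descendsIn_depth hdA
    rw [hk] at this
    exact mem_An_of_mem this
  | succ k ih =>
    by_cases hdZ : d ∈ Z
    · exact mem_An_of_mem hdZ
    obtain ⟨e, heA, hde, hdep'⟩ := exists_dir_depth hdA hdZ
    refine mem_An_of_dir (b := e) ?_ (ih hde heA hdep' ?_ (by omega)) <;>
    · have hadj : ¬ G.skel.Adj v e := fun hadj => by
        have := depth_le_of_dir (hG.dir_head_trans hd hde.1 hadj) heA
        omega
      have hne : v ≠ e := by
        rintro rfl
        omega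
      have hc := hGK.collider (u := v) (w := d) (v := e)
        ⟨G.adj_of_head hd.1, G.adj_of_head hde.1, hne, hadj⟩
      exact hK.dir_of_not_head (hGK.skel ▸ G.adj_of_head hde.1)
        fun h' => hde.2 (hc.2 ⟨hkd.1, h'⟩).2

/-! ### Equality of the m-separations -/

/-- Let `d` be the next vertex on a shortest descent from the collider. If scanning on neither side
forces the edge to `d` in `K`, the walk can be rerouted through `d`, with arrowheads from both
sides. Minimal length leaves only the exchange of the collider for `d`, which is closer to `Z`. -/
lemma Shortest.collider_mem_An {n : ℕ} {p : ℕ → V} (h : G.Shortest Z n p) (hG : G.SemiAcyclic)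
    (hK : K.SemiAcyclic) (hGK : G.SamePattern K)
    (hmin : ∀ q, G.Conn Z n q → q 0 = p 0 → q n = p n →
      ∑ t ∈ Finset.range (n + 1), G.depth Z (p t) ≤ ∑ t ∈ Finset.range (n + 1), G.depth Z (q t))
    {i : ℕ} (hi : i + 2 ≤ n) (h1 : G.head (p i) (p (i + 1)))
    (h2 : G.head (p (i + 2)) (p (i + 1))) : p (i + 1) ∈ K.An Z := by
  have hA := (h.conn.opened i hi).1 ⟨h1, h2⟩
  by_cases hZ : p (i + 1) ∈ Z
  · exact mem_An_of_mem hZ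
  obtain ⟨d, hdA, hd, hdep⟩ := exists_dir_depth hA hZ
  obtain ⟨k1, k2⟩ := h.collider_transfer hG hGK hi h1 h2
  suffices hkd : K.Dir (p (i + 1)) d from
    mem_An_of_dir hkd (mem_An_transfer hG hK hGK hd hdA hdep hkd)
  rcases h.scan hG hK hGK (m := i) (z := d) (by omega) hd
    (by rintro rfl; exact hd.2 h1) (fun hadj => hG.head_trans h1 hd.1 hadj) with
    ⟨j, hj, hj1, hj2⟩ | h'
  swap
  · exact h' k1
  rcases h.scan_right hG hK hGK (m := i + 1) (z := d) hi hd
    (by rintro rfl; exact hd.2 h2) (fun hadj => hG.head_trans h2 hd.1 hadj) with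
    ⟨k, hk, hkn, hk1, hk2⟩ | h'
  swap
  · exact h' k2
  exfalso
  obtain ⟨q, hq, e0, en, hqt⟩ := h.conn.replace (j := j) (k := k) (d := d) (by omega) hkn
    (G.adj_of_head hj1) (G.adj_of_head hk1).symm hj2
    ⟨fun _ => hdA, fun h' => (h' ⟨hj1, hk1⟩).elim⟩ hk2
  have hle := h.le _ q hq e0 en
  obtain rfl : j = i := by omega
  obtain rfl : k = j + 2 := by omega
  have hlen : j + 2 + (n - (j + 2)) = n := by omega
  rw [hlen] at hq en
  have hqt := hqt rfl
  -- Only one term changes. Its old and new vertex are both in `An Z`, so the default depth 0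
  -- outside `An Z` does no harm.
  have hlt : ∑ t ∈ Finset.range (n + 1), G.depth Z (q t)
      < ∑ t ∈ Finset.range (n + 1), G.depth Z (p t) := by
    refine Finset.sum_lt_sum (fun t _ => ?_) ⟨j + 1, by simp; omega, ?_⟩
    · rw [hqt t]
      split_ifs with ht
      · subst ht; omega
      · exact le_rfl
    · rw [hqt, if_pos rfl]
      omega
  exact absurd (hmin q hq e0 en) (not_le.2 hlt)

lemma Conn.exists_minimal {n : ℕ} {p : ℕ → V} (h : G.Conn Z n p) :
    ∃ m q, G.Shortest Z m q ∧ q 0 = p 0 ∧ q m = p n ∧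
      ∀ r, G.Conn Z m r → r 0 = q 0 → r m = q m →
        ∑ t ∈ Finset.range (m + 1), G.depth Z (q t)
          ≤ ∑ t ∈ Finset.range (m + 1), G.depth Z (r t) := by
  classical
  have h1 : ∃ m : ℕ, ∃ q, G.Conn Z m q ∧ q 0 = p 0 ∧ q m = p n := ⟨n, p, h, rfl, rfl⟩
  set m := Nat.find h1
  have h2 : ∃ s : ℕ, ∃ q, G.Conn Z m q ∧ q 0 = p 0 ∧ q m = p n ∧
      ∑ t ∈ Finset.range (m + 1), G.depth Z (q t) = s := by
    obtain ⟨q, hq, h0, hn⟩ := Nat.find_spec h1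
    exact ⟨_, q, hq, h0, hn, rfl⟩
  obtain ⟨q, hq, h0, hn, hs⟩ := Nat.find_spec h2
  refine ⟨m, q, ⟨hq, fun m' r hr e0 en => ?_⟩, h0, hn, fun r hr e0 en => ?_⟩
  · exact Nat.find_min' h1 ⟨r, hr, e0.trans h0, en.trans hn⟩
  · rw [hs]
    exact Nat.find_min' h2 ⟨r, hr, e0.trans h0, en.trans hn, rfl⟩

lemma SamePattern.mSep (hGK : G.SamePattern K) (hG : G.SemiAcyclic) (hK : K.SemiAcyclic)
    {X Y : Set V} (h : K.MSep X Y Z) : G.MSep X Y Z := by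
  intro a ha b hb q hq
  obtain ⟨m, p, hp, e0, en, hmin⟩ := hq.conn.exists_minimal
  have hc : K.Conn Z m p := by
    refine ⟨fun i hi => hGK.skel ▸ hp.conn.adj i hi, hp.conn.left, hp.conn.right, fun i hi => ?_⟩
    by_cases hcol : G.head (p i) (p (i + 1)) ∧ G.head (p (i + 2)) (p (i + 1))
    · exact ⟨fun _ => hp.collider_mem_An hG hK hGK hmin hi hcol.1 hcol.2,
        fun h' => (h' (hp.collider_transfer hG hGK hi hcol.1 hcol.2)).elim⟩
    · exact ⟨fun h' => (hp.noncollider_transfer hG hK hGK hi hcol h').elim,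
        fun _ => (hp.conn.opened i hi).2 hcol⟩
  obtain ⟨r, hr⟩ := hc.exists_mConnecting (hp.injOn hG)
  refine h (p 0) ?_ (p m) ?_ r hr
  · rw [e0]; simpa using ha
  · rw [en]; simpa using hb

lemma SamePattern.markovEquiv (hGK : G.SamePattern K) (hG : G.SemiAcyclic) (hK : K.SemiAcyclic) :
    MarkovEquiv G K := by
  ext ⟨X, Y, Z⟩
  exact and_congr_right fun _ => ⟨hGK.symm.mSep hK hG, hGK.mSep hG hK⟩

end MixedGraph

end MVR

namespace MVR

open MixedGraph

/-! ### Skeleton recovery -/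

lemma exists_runsTo {A : Type*} {step : A → A → Prop} (f : A → ℕ)
    (hf : ∀ x y, step x y → f y < f x) (x : A) : ∃ y, RunsTo step x y := by
  induction hn : f x using Nat.strong_induction_on generalizing x with
  | _ n ih =>
  by_cases h : ∃ y, step x y
  · obtain ⟨y, hy⟩ := h
    obtain ⟨z, hz, hz'⟩ := ih (f y) (hn ▸ hf x y hy) y rfl
    exact ⟨z, .head hy hz, hz'⟩
  · push Not at h
    exact ⟨x, .refl, h⟩

/-- The queries are answered as m-separation in `G` dictates. -/
def Oracle {V : Type*} (G : MixedGraph V) (ci : V → V → Set V → Prop) : Prop :=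
  ∀ (u v : V) (S : Set V), u ≠ v → u ∉ S → v ∉ S → (ci u v S ↔ G.MSep {u} {v} S)

section

variable {V : Type*} {G : MixedGraph V} {ci : V → V → Set V → Prop}

lemma EdgeRemoval.lt {i : ℕ} {a : V → Set V} {L M : SimpleGraph V}
    (h : EdgeRemoval ci i a L M) : M < L := by
  obtain ⟨u, v, huv, -, -, -, rfl⟩ := h
  refine lt_of_le_of_ne (SimpleGraph.deleteEdges_le _) fun he => ?_
  rw [← he] at huv
  simp at huv

lemma EdgeRemoval.le_of_le (hci : Oracle G ci) {i : ℕ} {a : V → Set V} {L M : SimpleGraph V}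
    (ha : ∀ u, u ∉ a u) (hL : G.skel ≤ L) (h : EdgeRemoval ci i a L M) : G.skel ≤ M := by
  obtain ⟨u, v, huv, -, -, ⟨S, hS, -, hs⟩, rfl⟩ := h
  have hu : u ∉ S := fun h => ha u (hS h).1
  have hv : v ∉ S := fun h => (hS h).2 rfl
  have hn : ¬ G.skel.Adj u v := fun hadj =>
    not_mSep_of_adj hadj hu hv ((hci u v S huv.ne hu hv).1 hs)
  intro x y hxy
  rw [SimpleGraph.deleteEdges_adj]
  refine ⟨hL hxy, fun he => ?_⟩
  rcases Sym2.eq_iff.1 (Set.mem_singleton_iff.1 he) with ⟨rfl, rfl⟩ | ⟨rfl, rfl⟩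
  · exact hn hxy
  · exact hn hxy.symm

lemma RunsTo.le_of_edgeRemoval {i : ℕ} {a : SimpleGraph V → V → Set V} {L M : SimpleGraph V}
    (h : Relation.ReflTransGen (fun L M => EdgeRemoval ci i (a L) L M) L M) : M ≤ L := by
  induction h with
  | refl => exact le_rfl
  | tail _ h' ih => exact h'.lt.le.trans ih

lemma SkeletonLevel.le {i : ℕ} {ver : SkeletonVersion} {L M : SimpleGraph V}
    (h : SkeletonLevel ci i ver L M) : M ≤ L := by
  cases ver
  · exact RunsTo.le_of_edgeRemoval (a := fun L => L.neighborSet) h.1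
  · exact RunsTo.le_of_edgeRemoval (a := fun _ => L.neighborSet) h.1

lemma SkeletonLevel.le_of_le (hci : Oracle G ci) {i : ℕ} {ver : SkeletonVersion}
    {L M : SimpleGraph V} (hL : G.skel ≤ L) (h : SkeletonLevel ci i ver L M) : G.skel ≤ M := by
  have key : ∀ (a : SimpleGraph V → V → Set V), (∀ L u, u ∉ a L u) →
      Relation.ReflTransGen (fun L M => EdgeRemoval ci i (a L) L M) L M → G.skel ≤ M := by
    intro a ha hr
    clear h
    induction hr with
    | refl => exact hL
    | tail _ h' ih => exact h'.le_of_le hci (ha _) ih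
  cases ver
  · exact key (fun L => L.neighborSet) (by simp) h.1
  · exact key (fun _ => L.neighborSet) (by simp) h.1

/-- The current graph contains the skeleton of `G`, so the parents of `u` are available as a
conditioning set at the level of their number. A surviving edge would contradict halting, for the
current adjacency sets as well as for the larger ones frozen at the start of the level. -/
lemma SkeletonLevel.not_adj [Finite V] (hci : Oracle G ci) {ver : SkeletonVersion}
    {L M : SimpleGraph V} {u v : V} (hL : G.skel ≤ L)
    (h : SkeletonLevel ci (G.parents u).ncard ver L M) (hn : ¬ G.skel.Adj u v)
    (hs : G.MSep {u} {v} (G.parents u)) : ¬ M.Adj u v := by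
  intro huv
  have hle := h.le
  have hGM := h.le_of_le hci hL
  have hu : u ∉ G.parents u := fun h => (G.adj_of_head h.1).ne rfl
  have hv : v ∉ G.parents u := fun h => hn (G.adj_of_head h.1).symm
  have hc := (hci u v _ huv.ne hu hv).2 hs
  have key : ∀ a : V → Set V, u ∈ a v → G.skel.neighborSet u ⊆ a u →
      EdgeRemoval ci (G.parents u).ncard a M (M.deleteEdges {s(u, v)}) := by
    intro a ha hsub
    have hp : G.parents u ⊆ a u \ {v} := fun x hx =>
      ⟨hsub (parents_subset u hx), fun he => hv (he ▸ hx)⟩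
    exact ⟨u, v, huv, ha, Set.ncard_le_ncard hp (Set.toFinite _), ⟨_, hp, rfl, hc⟩, rfl⟩
  cases ver
  · exact h.2 _ (key M.neighborSet huv.symm fun x hx => hGM hx)
  · exact h.2 _ (key L.neighborSet (hle huv.symm) fun x hx => hL hx)

lemma SkeletonUpTo.le_of_oracle (hci : Oracle G ci) {ver : SkeletonVersion} {n : ℕ}
    {H : SimpleGraph V} (h : SkeletonUpTo ci ver n H) : G.skel ≤ H := by
  induction n generalizing H with
  | zero => exact (show H = ⊤ from h) ▸ le_top
  | succ n ih =>
    obtain ⟨K, hK, hlev⟩ := h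
    exact hlev.le_of_le hci (ih hK)

lemma SkeletonUpTo.not_adj [Finite V] (hci : Oracle G ci) {ver : SkeletonVersion} {n : ℕ}
    {H : SimpleGraph V} (h : SkeletonUpTo ci ver n H) {u v : V} (hn : ¬ G.skel.Adj u v)
    (hs : G.MSep {u} {v} (G.parents u)) (hlt : (G.parents u).ncard < n) : ¬ H.Adj u v := by
  induction n generalizing H with
  | zero => omega
  | succ n ih =>
    obtain ⟨K, hK, hlev⟩ := h
    rcases Nat.lt_succ_iff_lt_or_eq.1 hlt with h1 | h1
    · exact fun hadj => ih hK h1 (hlev.le hadj)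
    · subst h1
      exact hlev.not_adj hci (hK.le_of_oracle hci) hn hs

lemma exists_skeletonUpTo [Finite V] (ci : V → V → Set V → Prop) (ver : SkeletonVersion) (n : ℕ) :
    ∃ H, SkeletonUpTo ci ver n H := by
  induction n with
  | zero => exact ⟨⊤, rfl⟩
  | succ n ih =>
    obtain ⟨K, hK⟩ := ih
    have hf : ∀ (L M : SimpleGraph V) (a : V → Set V), EdgeRemoval ci n a L M →
        M.edgeSet.ncard < L.edgeSet.ncard := fun L M a h =>
      Set.ncard_lt_ncard (SimpleGraph.edgeSet_ssubset_edgeSet.2 h.lt) (Set.toFinite _)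
    cases ver
    · obtain ⟨H, hH⟩ := exists_runsTo (fun L => L.edgeSet.ncard)
        (fun L M (h : EdgeRemoval ci n L.neighborSet L M) => hf L M _ h) K
      exact ⟨H, K, hK, hH⟩
    · obtain ⟨H, hH⟩ := exists_runsTo (fun L => L.edgeSet.ncard)
        (fun L M (h : EdgeRemoval ci n K.neighborSet L M) => hf L M _ h) K
      exact ⟨H, K, hK, hH⟩

lemma SkeletonResult.eq [Fintype V] (hci : Oracle G ci) (hG : G.SemiAcyclic)
    {ver : SkeletonVersion} {H : SimpleGraph V} (h : SkeletonResult ci ver H) : H = G.skel := by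
  -- The parents of `u` include neither `u` nor `v`, so there are at most `|V| - 2` of them and
  -- their level is carried out.
  have hcard : ∀ u v, u ≠ v → ¬ G.skel.Adj u v → (G.parents u).ncard < Fintype.card V - 1 := by
    intro u v huv hn
    have hsub : G.parents u ⊆ ({u, v} : Set V)ᶜ := by
      rintro x hx (rfl | rfl)
      · exact (G.adj_of_head hx.1).ne rfl
      · exact hn (G.adj_of_head hx.1).symm
    have h1 := Set.ncard_le_ncard hsub (Set.toFinite _)
    have h2 := Set.ncard_add_ncard_compl ({u, v} : Set V)
    rw [Set.ncard_pair huv, Nat.card_eq_fintype_card] at h2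
    omega
  refine le_antisymm (fun u v huv => ?_) (SkeletonUpTo.le_of_oracle hci h)
  by_contra hn
  rcases hG.mSep_parents_or huv.ne hn with hs | hs
  · exact SkeletonUpTo.not_adj hci h hn hs (hcard u v huv.ne hn) huv
  · have hn' : ¬ G.skel.Adj v u := fun h' => hn h'.symm
    exact SkeletonUpTo.not_adj hci h hn' hs.symm (hcard v u huv.ne.symm hn') huv.symm

/-! ### Recovery of the v-structures -/

lemma mSep_of_mem_sepSets (hci : Oracle G ci) {u v : V} (huv : u ≠ v) (hn : ¬ G.skel.Adj u v)
    {S : Set V} (hS : S ∈ sepSets ci G.skel u v) : u ∉ S ∧ v ∉ S ∧ G.MSep {u} {v} S := by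
  obtain ⟨hsub, hs⟩ := hS
  have hu : u ∉ S := fun h => hsub.elim (fun h' => SimpleGraph.irrefl _ (h' h))
    (fun h' => hn (SimpleGraph.Adj.symm (h' h)))
  have hv : v ∉ S := fun h => hsub.elim (fun h' => hn (h' h))
    (fun h' => SimpleGraph.irrefl _ (h' h))
  exact ⟨hu, hv, (hci u v S huv hu hv).1 hs⟩

lemma sepSets_nonempty (hci : Oracle G ci) (hG : G.SemiAcyclic) {u v : V} (huv : u ≠ v)
    (hn : ¬ G.skel.Adj u v) : (sepSets ci G.skel u v).Nonempty := by
  have hu : u ∉ G.parents u := fun h => (G.adj_of_head h.1).ne rfl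
  have hv : v ∉ G.parents v := fun h => (G.adj_of_head h.1).ne rfl
  rcases hG.mSep_parents_or huv hn with hs | hs
  · exact ⟨_, Or.inl (parents_subset u), (hci u v _ huv hu
      fun h => hn (G.adj_of_head h.1).symm).2 hs⟩
  · exact ⟨_, Or.inr (parents_subset v), (hci u v _ huv
      (fun h => hn (G.adj_of_head h.1)) hv).2 hs⟩

lemma percentage_eq_zero {F : Set (Set V)} {w : V} (h : ∀ S ∈ F, w ∉ S) : percentage F w = 0 := by
  have : {S ∈ F | w ∈ S} = ∅ := by
    ext S
    simpa using h S
  simp [percentage, this]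

lemma percentage_eq_hundred [Finite V] {F : Set (Set V)} {w : V} (hF : F.Nonempty)
    (h : ∀ S ∈ F, w ∈ S) : percentage F w = 100 := by
  have : {S ∈ F | w ∈ S} = F := by
    ext S
    simpa using h S
  have hc : (F.ncard : ℝ) ≠ 0 := by
    exact_mod_cast ((Set.ncard_pos (Set.toFinite _)).2 hF).ne'
  rw [percentage, this]
  field_simp

variable {rule : TripleRule}

/-- If the sets found agree about `w`, the percentage is 0 or 100, where the thresholds have no
influence: the clause "in none" covers `α = 0`, and `100 < α` is excluded. -/
lemma accepts_and_orients_iff [Finite V] (hrule : rule.Valid) {F : Set (Set V)} {w : V}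
    (hF : F.Nonempty) {P : Prop} (h0 : P → ∀ S ∈ F, w ∉ S) (h1 : ¬ P → ∀ S ∈ F, w ∈ S) :
    rule.Accepts F w ∧ (rule.Orients F w ↔ P) := by
  obtain ⟨S, hS⟩ := hF
  by_cases hP : P
  · cases rule with
    | cpc => exact ⟨⟨⟨S, hS⟩, Or.inr (h0 hP)⟩, iff_of_true (h0 hP) hP⟩
    | mpc α β =>
      refine ⟨⟨⟨S, hS⟩, Or.inl ?_⟩, iff_of_true (Or.inr (h0 hP)) hP⟩
      rw [percentage_eq_zero (h0 hP)]
      exact hrule.1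
  · have hn : ¬ ∀ S ∈ F, w ∉ S := fun h => h S hS (h1 hP S hS)
    cases rule with
    | cpc => exact ⟨⟨⟨S, hS⟩, Or.inl (h1 hP)⟩, iff_of_false hn hP⟩
    | mpc α β =>
      have h100 := percentage_eq_hundred ⟨S, hS⟩ (h1 hP)
      refine ⟨⟨⟨S, hS⟩, Or.inr ?_⟩, iff_of_false (not_or.2 ⟨?_, hn⟩) hP⟩
      · rw [h100]
        exact hrule.2.2
      · rw [h100, not_lt]
        exact hrule.2.1.trans hrule.2.2

lemma triple_labels [Finite V] (hci : Oracle G ci) (hG : G.SemiAcyclic) (hrule : rule.Valid)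
    {u w v : V} (h : Unshielded G.skel u w v) :
    rule.Accepts (sepSets ci G.skel u v) w ∧
      (rule.Orients (sepSets ci G.skel u v) w ↔ (G.head u w ∧ G.head v w)) := by
  refine accepts_and_orients_iff hrule (sepSets_nonempty hci hG h.2.2.1 h.2.2.2) ?_ ?_
  · intro hc S hS
    obtain ⟨hu, hv, hs⟩ := mSep_of_mem_sepSets hci h.2.2.1 h.2.2.2 hS
    exact notMem_of_collider_of_mSep h hu hv hs hc
  · intro hc S hS
    obtain ⟨hu, hv, hs⟩ := mSep_of_mem_sepSets hci h.2.2.1 h.2.2.2 hS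
    by_contra hw
    exact hc (collider_of_mSep_of_notMem h hu hv hs hw)

lemma vStructure_iff [Finite V] (hci : Oracle G ci) (hG : G.SemiAcyclic) (hrule : rule.Valid)
    {u w v : V} : VStructure ci rule G.skel u w v ↔
      Unshielded G.skel u w v ∧ G.head u w ∧ G.head v w :=
  ⟨fun h => ⟨h.1.1, (triple_labels hci hG hrule h.1.1).2.1 h.2⟩, fun h =>
    ⟨⟨h.1, (triple_labels hci hG hrule h.1).1⟩, (triple_labels hci hG hrule h.1).2.2 h.2⟩⟩

lemma nonVStructure_iff [Finite V] (hci : Oracle G ci) (hG : G.SemiAcyclic) (hrule : rule.Valid)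
    {u w v : V} : NonVStructure ci rule G.skel u w v ↔
      Unshielded G.skel u w v ∧ ¬ (G.head u w ∧ G.head v w) :=
  ⟨fun h => ⟨h.1.1, fun h' => h.2 ((triple_labels hci hG hrule h.1.1).2.2 h')⟩, fun h =>
    ⟨⟨h.1, (triple_labels hci hG hrule h.1).1⟩,
      fun h' => h.2 ((triple_labels hci hG hrule h.1).2.1 h')⟩⟩

lemma ambiguousTriples_eq_empty [Finite V] (hci : Oracle G ci) (hG : G.SemiAcyclic)
    (hrule : rule.Valid) : ambiguousTriples ci rule G.skel = ∅ := by
  ext ⟨u, w, v⟩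
  simp only [ambiguousTriples, Set.mem_ofPred_eq, Set.mem_empty_iff_false, iff_false, not_and,
    not_not]
  exact fun h => ⟨h, (triple_labels hci hG hrule h).1⟩

end

end MVR

/-! ### Fixed points of the orientation rules -/

namespace MVR

namespace MixedGraph

variable {V : Type*} {G K M : MixedGraph V}

/-- The properties of a graph `M` that results from exhaustive application of the orientation
rules to the v-structures of `G`. -/
structure IsEssential (G M : MixedGraph V) : Prop where
  skel : M.skel = G.skel
  sound : ∀ {K : MixedGraph V}, K.SemiAcyclic → G.SamePattern K →
    ∀ {a b : V}, M.head a b → K.head a b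
  collider : ∀ {u w v : V}, Unshielded G.skel u w v → G.head u w → G.head v w → M.head u w
  adj_of_head_undir : ∀ {a b c : V}, M.head a b → M.Undir b c → M.skel.Adj a c
  head_trans : ∀ {a b c : V}, M.head a b → M.head b c → M.skel.Adj a c → M.head a c
  head_of_diamond : ∀ {a b c d : V}, M.head c b → M.head d b → Unshielded G.skel c a d →
    ¬ (G.head c a ∧ G.head d a) → M.skel.Adj a b → M.head a b
  head_undir : ∀ {a b c : V}, M.head a b → M.Undir b c → M.head a c

lemma SamePattern.refl (G : MixedGraph V) : G.SamePattern G := ⟨rfl, fun _ => Iff.rfl⟩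

lemma Undir.symm {a b : V} (h : M.Undir a b) : M.Undir b a := ⟨h.1.symm, h.2.2, h.2.1⟩

lemma _root_.MVR.Unshielded.symm {H : SimpleGraph V} {u w v : V} (h : Unshielded H u w v) :
    Unshielded H v w u := ⟨h.2.1.symm, h.1.symm, h.2.2.1.symm, fun h' => h.2.2.2 h'.symm⟩

section Rules

variable {ci : V → V → Set V → Prop} {rule : TripleRule}

lemma RuleStep.skel_eq {H : SimpleGraph V} {L N : MixedGraph V}
    (h : Relation.ReflTransGen (RuleStep ci rule H) L N) : N.skel = L.skel := by
  induction h with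
  | refl => rfl
  | tail _ h' ih =>
    obtain ⟨x, y, -, hs, -⟩ := h'
    exact hs.trans ih

lemma RuleStep.head_mono {H : SimpleGraph V} {L N : MixedGraph V}
    (h : Relation.ReflTransGen (RuleStep ci rule H) L N) {a b : V} (hab : L.head a b) :
    N.head a b := by
  induction h with
  | refl => exact hab
  | tail _ h' ih =>
    obtain ⟨x, y, -, -, hs⟩ := h'
    exact (hs a b).2 (Or.inl ih)

lemma vStructureGraph_head [Finite V] (hci : Oracle G ci) (hG : G.SemiAcyclic) (hrule : rule.Valid)
    {u w : V} : (vStructureGraph ci rule G.skel).head u w ↔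
      ∃ v, Unshielded G.skel u w v ∧ G.head u w ∧ G.head v w := by
  refine exists_congr fun v => ?_
  rw [vStructure_iff hci hG hrule, vStructure_iff hci hG hrule]
  exact ⟨fun h => h.elim id fun h => ⟨h.1.symm, h.2.2, h.2.1⟩, Or.inl⟩

/-- If an arrowhead placed by R1 or R3 were missing in `K`, the edge would point the other way and
create an unshielded collider there that `G` does not have. R2 is transitivity of arrowheads. -/
lemma head_of_rules [Finite V] (hci : Oracle G ci) (hG : G.SemiAcyclic) (hrule : rule.Valid)
    (hK : K.SemiAcyclic) (hGK : G.SamePattern K)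
    (h : Relation.ReflTransGen (RuleStep ci rule G.skel) (vStructureGraph ci rule G.skel) M)
    {a b : V} (hab : M.head a b) : K.head a b := by
  induction h generalizing a b with
  | refl =>
    obtain ⟨v, hu, hc⟩ := (vStructureGraph_head hci hG hrule).1 hab
    exact ((hGK.collider hu).1 hc).1
  | @tail L N hL hstep ih =>
    obtain ⟨x, y, hf, -, hs⟩ := hstep
    have hskel : L.skel = K.skel := (RuleStep.skel_eq hL).trans hGK.skel
    rcases (hs a b).1 hab with h' | ⟨rfl, rfl⟩
    · exact ih h'
    · cases hf with
      | r1 e _ _ he hu hnv =>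
        obtain ⟨hun, hnc⟩ := (nonVStructure_iff hci hG hrule).1 hnv
        have hadj : K.skel.Adj a b := hskel ▸ hu.1
        refine (hK.total hadj).resolve_right fun h' => ?_
        exact hnc ((hGK.collider hun).2 ⟨ih he, h'⟩)
      | r2 _ e _ he hc hadj _ => exact hK.head_trans (ih he) (ih hc) (hskel ▸ hadj)
      | r3 _ _ c d hc hd hnv hadj _ =>
        obtain ⟨hun, hnc⟩ := (nonVStructure_iff hci hG hrule).1 hnv
        refine (hK.total (hskel ▸ hadj)).resolve_right fun h' => ?_
        have h1 : K.skel.Adj c a := hGK.skel ▸ hun.1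
        have h2 : K.skel.Adj d a := hGK.skel ▸ hun.2.1.symm
        exact hnc ((hGK.collider hun).2
          ⟨hK.head_trans (ih hc) h' h1, hK.head_trans (ih hd) h' h2⟩)

lemma isEssential_of_runsTo [Finite V] (hci : Oracle G ci) (hG : G.SemiAcyclic) (hrule : rule.Valid)
    (h : RunsTo (RuleStep ci rule G.skel) (vStructureGraph ci rule G.skel) M) :
    G.IsEssential M := by
  have hskel : M.skel = (vStructureGraph ci rule G.skel).skel := RuleStep.skel_eq h.1
  change M.skel = G.skel at hskel
  have hfinal : ∀ x y, M.skel.Adj x y → ¬ RuleFires ci rule G.skel M x y := by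
    intro x y hxy hf
    refine h.2 ⟨M.skel, fun u v => M.head u v ∨ (u = x ∧ v = y), ?_⟩
      ⟨x, y, hf, rfl, fun _ _ => Iff.rfl⟩
    rintro u v (h' | ⟨rfl, rfl⟩)
    · exact M.adj_of_head h'
    · exact hxy
  have hcol : ∀ {u w v : V}, Unshielded G.skel u w v → G.head u w → G.head v w → M.head u w :=
    fun hu h1 h2 => RuleStep.head_mono h.1 ((vStructureGraph_head hci hG hrule).2 ⟨_, hu, h1, h2⟩)
  have htrans : ∀ {a b c : V}, M.head a b → M.head b c → M.skel.Adj a c → M.head a c := by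
    intro a b c hab hbc hac
    by_contra hn
    exact hfinal a c hac (.r2 a b c hab hbc hac hn)
  have hdiam : ∀ {a b c d : V}, M.head c b → M.head d b → Unshielded G.skel c a d →
      ¬ (G.head c a ∧ G.head d a) → M.skel.Adj a b → M.head a b := by
    intro a b c d hcb hdb hu hnc hab
    by_contra hn
    exact hfinal a b hab (.r3 a b c d hcb hdb ((nonVStructure_iff hci hG hrule).2 ⟨hu, hnc⟩) hab hn)
  have hadj : ∀ {a b c : V}, M.head a b → M.Undir b c → M.skel.Adj a c := by
    intro a b c hab hbc
    by_contra hn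
    have hne : a ≠ c := by
      rintro rfl
      exact hbc.2.2 hab
    have hu : Unshielded G.skel a b c :=
      ⟨hskel ▸ M.adj_of_head hab, hskel ▸ hbc.1, hne, hskel ▸ hn⟩
    by_cases hc : G.head a b ∧ G.head c b
    · exact hbc.2.2 (hcol hu.symm hc.2 hc.1)
    · exact hfinal b c hbc.1 (.r1 a b c hab hbc ((nonVStructure_iff hci hG hrule).2 ⟨hu, hc⟩))
  -- An arrowhead at `a` from `c` would pass through `a` to `b` by R2.
  have hundir : ∀ {a b c : V}, M.head a b → M.Undir b c → ¬ M.head a c → M.Undir a c := by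
    intro a b c hab hbc hn
    have hac := hadj hab hbc
    exact ⟨hac, hn, fun hca => hbc.2.2 (htrans hca hab hbc.1.symm)⟩
  refine ⟨hskel, fun hK hGK _ _ hab => head_of_rules hci hG hrule hK hGK h.1 hab, hcol, hadj,
    htrans, hdiam, ?_⟩
  -- Induction over the run, in the order in which arrowheads appear. `Undir` always refers to the
  -- final graph, while the arrowhead into `b` belongs to the intermediate one.
  suffices H : ∀ L, Relation.ReflTransGen (RuleStep ci rule G.skel)
      (vStructureGraph ci rule G.skel) L → (∀ a b, L.head a b → M.head a b) →
      ∀ a b c, L.head a b → M.Undir b c → M.head a c from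
    fun {_ _ _} hab hbc => H M h.1 (fun _ _ => id) _ _ _ hab hbc
  intro L hL
  induction hL with
  | refl =>
    intro hLM a b c hab hbc
    by_contra hn
    obtain ⟨d, hu, h1, h2⟩ := (vStructureGraph_head hci hG hrule).1 hab
    have hac := hundir (hLM _ _ hab) hbc hn
    have hdb : M.head d b := hcol hu.symm h2 h1
    have had : ¬ M.skel.Adj d a := fun h' => hu.2.2.2 (hskel ▸ h'.symm)
    -- In the v-structure `a *→ b ←* d` both `a` and `d` turn out to be joined to `c` by undirected
    -- edges. Then R3 puts an arrowhead at `b` on the edge from `c`.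
    by_cases hdc : M.head d c
    · exact had (hadj hdc hac.symm)
    · have hdc' := hundir hdb hbc hdc
      have hun : Unshielded G.skel a c d :=
        ⟨hskel ▸ hac.1, hskel ▸ hdc'.1.symm, hu.2.2.1, hu.2.2.2⟩
      exact hbc.2.2 (hdiam (hLM _ _ hab) hdb hun (fun h' => hn (hcol hun h'.1 h'.2)) hbc.1.symm)
  | @tail L N _ hstep ih =>
    intro hNM a b c hab hbc
    obtain ⟨x, y, hf, -, hs⟩ := hstep
    have hLM : ∀ a b, L.head a b → M.head a b := fun a b h' => hNM a b ((hs a b).2 (Or.inl h'))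
    have ih := ih hLM
    rcases (hs a b).1 hab with h' | ⟨rfl, rfl⟩
    · exact ih a b c h' hbc
    have hab' := hNM a b hab
    by_contra hn
    have hac := hundir hab' hbc hn
    cases hf with
    | r1 e _ _ he hu hnv =>
      have hec := ih e a c he hac
      have := hadj hec hbc.symm
      rw [hskel] at this
      exact hnv.1.1.2.2.2 this
    | r2 _ e _ he hc hadj _ => exact hn (htrans (hLM _ _ he) (ih e b c hc hbc) hac.1)
    | r3 _ _ e d he hd hnv hadj _ =>
      obtain ⟨hun, hnc⟩ := (nonVStructure_iff hci hG hrule).1 hnv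
      exact hn (hdiam (ih e b c he hbc) (ih d b c hd hbc) hun hnc hac.1)

lemma exists_runsTo_ruleStep [Finite V] (H : SimpleGraph V) (L : MixedGraph V) :
    ∃ M, RunsTo (RuleStep ci rule H) L M := by
  refine exists_runsTo (fun M => {e : V × V | ¬ M.head e.1 e.2}.ncard) ?_ L
  rintro M N ⟨x, y, hf, -, hs⟩
  have hn : ¬ M.head x y := by
    cases hf with
    | r1 _ _ _ _ hu _ => exact hu.2.1
    | r2 _ _ _ _ _ _ hn => exact hn
    | r3 _ _ _ _ _ _ _ _ hn => exact hn
  have hsub : {e : V × V | ¬ N.head e.1 e.2} ⊆ {e : V × V | ¬ M.head e.1 e.2} :=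
    fun e he h' => he ((hs e.1 e.2).2 (Or.inl h'))
  refine Set.ncard_lt_ncard ?_ (Set.toFinite _)
  rw [Set.ssubset_iff_of_subset hsub]
  exact ⟨(x, y), hn, fun h' => h' ((hs x y).2 (Or.inr ⟨rfl, rfl⟩))⟩

end Rules

/-! ### Extending an essential graph -/

namespace IsEssential

lemma head_undir_star (h : G.IsEssential M) {a b c : V} (hab : M.head a b)
    (hbc : Relation.ReflTransGen M.Undir b c) : M.head a c := by
  induction hbc with
  | refl => exact hab
  | tail _ h' ih => exact h.head_undir ih h'

/-- The arrowhead from `a` carries over to `c`, and then R2 along `b *→ a *→ c` puts one on the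
undirected edge. -/
lemma not_bidir (h : G.IsEssential M) {a b c : V} (hab : M.head a b) (hba : M.head b a)
    (hbc : M.Undir b c) : False :=
  hbc.2.1 (h.head_trans hba (h.head_undir hab hbc) hbc.1)

/-- If the last vertex `x` before `b` is adjacent to `a`, shorten the walk to end in `x`. Otherwise
`G` closes the walk, and `a`, `x` meet in an unshielded collider at `b`, whose arrowheads `M` has.
-/
lemma closes (h : G.IsEssential M) (hG : G.SemiAcyclic) {a b : V}
    (hab : Relation.ReflTransGen M.head a b) (hba : M.head b a) : M.head a b := by
  have hGM : ∀ {a b}, M.head a b → G.head a b := h.sound hG (.refl G)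
  induction hab with
  | refl => exact hba
  | @tail x b hax hxb ih =>
    by_cases hne : x = a
    · exact hne ▸ hxb
    by_cases hadj : M.skel.Adj x a
    · exact h.head_trans (ih (h.head_trans hxb hba hadj)) hxb (M.adj_of_head hba).symm
    · have hGb : G.head a b := hG.closes
        (Relation.ReflTransGen.mono (fun _ _ h' => hGM h') _ _ (hax.tail hxb)) (hGM hba)
      exact h.collider ⟨G.adj_of_head hGb, h.skel ▸ (M.adj_of_head hxb).symm, fun h' => hne h'.symm,
        fun h' => hadj (h.skel ▸ h'.symm)⟩ hGb (hGM hxb)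

lemma undir_of_adj (h : G.IsEssential M) {a b c : V} (hab : M.Undir a b) (hbc : M.Undir b c)
    (hac : M.skel.Adj a c) : M.Undir a c :=
  ⟨hac, fun h' => hab.2.1 (h.head_undir h' hbc.symm),
    fun h' => hbc.2.2 (h.head_undir h' hab)⟩

/-- Earlier neighbours of a vertex are adjacent. -/
structure _root_.MVR.PerfectOrder (U : SimpleGraph V) (ord : V → ℕ) : Prop where
  injective : Function.Injective ord
  adj : ∀ {x y z : V}, U.Adj x y → U.Adj z y → ord x < ord y → ord z < ord y → x ≠ z → U.Adj x z

variable {ord : V → ℕ}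

/-- By `head_undir`, undirected edges after an arrowhead of `M` are absorbed into it, so only an
initial undirected stretch remains. -/
lemma orient_walk (h : G.IsEssential M) {a b : V}
    (hab : Relation.ReflTransGen (M.orientUndirected ord).head a b) :
    (Relation.ReflTransGen M.Undir a b ∧ (a = b ∨ ord a < ord b)) ∨
      ∃ a' x, Relation.ReflTransGen M.Undir a a' ∧ Relation.ReflTransGen M.head a' x ∧
        M.head x b := by
  induction hab with
  | refl => exact Or.inl ⟨.refl, Or.inl rfl⟩
  | @tail b c _ hbc ih =>
    rcases hbc with hbc | ⟨hbc, hlt⟩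
    · refine Or.inr ?_
      rcases ih with ⟨h1, -⟩ | ⟨a', x, h1, h2, h3⟩
      · exact ⟨b, b, h1, .refl, hbc⟩
      · exact ⟨a', b, h1, h2.tail h3, hbc⟩
    · rcases ih with ⟨h1, h2⟩ | ⟨a', x, h1, h2, h3⟩
      · refine Or.inl ⟨h1.tail hbc, Or.inr ?_⟩
        rcases h2 with rfl | h2
        · exact hlt
        · exact h2.trans hlt
      · exact Or.inr ⟨a', x, h1, h2, h.head_undir h3 hbc⟩

lemma semiAcyclic_orient (h : G.IsEssential M) (hG : G.SemiAcyclic)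
    (hord : Function.Injective ord) : (M.orientUndirected ord).SemiAcyclic where
  total {a b} hab := by
    by_contra hn
    push Not at hn
    have hu : M.Undir a b := ⟨hab, fun h' => hn.1 (Or.inl h'), fun h' => hn.2 (Or.inl h')⟩
    rcases lt_trichotomy (ord a) (ord b) with h' | h' | h'
    · exact hn.1 (Or.inr ⟨hu, h'⟩)
    · exact hu.1.ne (hord h')
    · exact hn.2 (Or.inr ⟨hu.symm, h'⟩)
  closes {a b} hab hba := by
    have hends : ∀ {a a' : V}, Relation.ReflTransGen M.Undir a a' → a = a' ∨
        ∃ c, M.Undir a' c := fun h' => by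
      rcases Relation.ReflTransGen.cases_tail h' with rfl | ⟨c, -, hc⟩
      · exact Or.inl rfl
      · exact Or.inr ⟨c, hc.symm⟩
    -- Undirected stretches are increasing for `ord`, so they do not close. Otherwise arrowheads are
    -- carried back to `a'` and the walk closes in `M`; the resulting bidirected edge cannot meet an
    -- undirected one, so the initial stretch is trivial and the closing edge has its arrowhead in
    -- `M`.
    rcases h.orient_walk hab with ⟨h1, h2⟩ | ⟨a', x, h1, h2, h3⟩
    · rcases hba with hba | ⟨hba, hlt⟩
      · exact (head_irrefl _ (h.head_undir_star hba h1)).elim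
      · rcases h2 with rfl | h2 <;> omega
    · rcases hba with hba | ⟨hba, hlt⟩
      · have hba' := h.head_undir_star hba h1
        have ha'b := h.closes hG (h2.tail h3) hba'
        rcases hends h1 with rfl | ⟨c, hc⟩
        · exact Or.inl ha'b
        · exact (h.not_bidir hba' ha'b hc).elim
      · have hxa' := h.head_undir_star (h.head_undir h3 hba) h1
        have ha'x := h.closes hG h2 hxa'
        rcases hends h1 with rfl | ⟨c, hc⟩
        · exact (h.not_bidir hxa' ha'x hba.symm).elim
        · exact (h.not_bidir hxa' ha'x hc).elim

/-- A new collider uses a formerly undirected edge. It is shielded by `head_undir` if its other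
arrowhead is in `M`, and by the perfect order if both edges were undirected. -/
lemma samePattern_orient (h : G.IsEssential M) (hG : G.SemiAcyclic)
    (hord : PerfectOrder M.undirectedPart ord) : G.SamePattern (M.orientUndirected ord) where
  skel := h.skel.symm
  collider {u w v} hu := by
    have hGM : ∀ {a b}, M.head a b → G.head a b := h.sound hG (.refl G)
    have hn : ¬ M.skel.Adj u v := h.skel ▸ hu.2.2.2
    refine ⟨fun hc => ⟨Or.inl (h.collider hu hc.1 hc.2), Or.inl (h.collider hu.symm hc.2 hc.1)⟩, ?_⟩
    rintro ⟨h1 | ⟨h1, l1⟩, h2 | ⟨h2, l2⟩⟩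
    · exact ⟨hGM h1, hGM h2⟩
    · exact (hn (M.adj_of_head (h.head_undir h1 h2.symm))).elim
    · exact (hn (M.adj_of_head (h.head_undir h2 h1.symm)).symm).elim
    · exact (hn (hord.adj (U := M.undirectedPart) h1 h2 l1 l2 hu.2.2.1).1).elim

lemma bidirEdges_orient_subset (h : G.IsEssential M) (hK : K.SemiAcyclic) (hGK : G.SamePattern K) :
    (M.orientUndirected ord).bidirEdges ⊆ K.bidirEdges := by
  rintro ⟨a, b⟩ ⟨h1, h2⟩
  rcases h1 with h1 | ⟨h1, l1⟩
  · rcases h2 with h2 | ⟨h2, l2⟩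
    · exact ⟨h.sound hK hGK h1, h.sound hK hGK h2⟩
    · exact (h2.2.2 h1).elim
  · rcases h2 with h2 | ⟨h2, l2⟩
    · exact (h1.2.2 h2).elim
    · exact absurd l1 l2.not_gt

end IsEssential

/-! ### The undirected part is chordal -/

/-- Two nonadjacent neighbours of `v` are not joined by a path outside the neighbourhood of `v`;
equivalently there is no chordless cycle of length at least four. -/
def _root_.MVR.IsChordal (U : SimpleGraph V) : Prop :=
  ∀ v x y c d : V, U.Adj v x → U.Adj v y → x ≠ y → U.Adj x c → U.Adj d y → c ≠ v → ¬ U.Adj v c →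
    Relation.ReflTransGen (fun a b => U.Adj a b ∧ b ≠ v ∧ ¬ U.Adj v b) c d → U.Adj x y

lemma not_adj_getVert_of_length_eq_dist {Γ : SimpleGraph V} {x y : V} (q : Γ.Walk x y)
    (hq : q.length = Γ.dist x y) {i : ℕ} (hi : i + 2 ≤ q.length) :
    q.getVert i ≠ q.getVert (i + 2) ∧ ¬ Γ.Adj (q.getVert i) (q.getVert (i + 2)) := by
  refine ⟨fun he => ?_, fun hadj => ?_⟩
  · have := SimpleGraph.dist_le ((q.take i).append ((q.drop (i + 2)).copy he.symm rfl))
    simp only [SimpleGraph.Walk.length_append, SimpleGraph.Walk.length_copy,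
      SimpleGraph.Walk.take_length, SimpleGraph.Walk.drop_length] at this
    omega
  · have := SimpleGraph.dist_le ((q.take i).append (.cons hadj (q.drop (i + 2))))
    simp only [SimpleGraph.Walk.length_append, SimpleGraph.Walk.length_cons,
      SimpleGraph.Walk.take_length, SimpleGraph.Walk.drop_length] at this
    omega

/-- Without colliders at the `p i`, one arrowhead from `v` forces every further edge to be directed
onwards, until the last one points into `v` and closes the walk. -/
lemma SemiAcyclic.no_noncollider_cycle (hG : G.SemiAcyclic) {k : ℕ} {p : ℕ → V} {v : V}
    (hadj : ∀ i < k, G.skel.Adj (p i) (p (i + 1))) (hv : G.skel.Adj (p k) v)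
    (h0 : ¬ (G.head v (p 0) ∧ G.head (p 1) (p 0)))
    (hi : ∀ i, i + 2 ≤ k → ¬ (G.head (p i) (p (i + 1)) ∧ G.head (p (i + 2)) (p (i + 1))))
    (hk : ∀ i, i + 1 = k → ¬ (G.head (p i) (p k) ∧ G.head v (p k)))
    (hk0 : 0 < k) : ¬ G.head v (p 0) := by
  intro hh
  have hall : ∀ i < k, G.Dir (p i) (p (i + 1)) := by
    intro i
    induction i with
    | zero => exact fun h => hG.dir_of_not_head (hadj 0 h) fun h' => h0 ⟨hh, h'⟩
    | succ i ih =>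
      exact fun h => hG.dir_of_not_head (hadj _ h) fun h' =>
        hi i (by omega) ⟨(ih (by omega)).1, h'⟩
  obtain ⟨m, rfl⟩ : ∃ m, k = m + 1 := ⟨k - 1, by omega⟩
  have hd : G.Dir (p (m + 1)) v := hG.dir_of_not_head hv
    fun h' => hk m rfl ⟨(hall m (by omega)).1, h'⟩
  exact hG.not_dir_of_reach ((Relation.ReflTransGen.single hh).trans
    (reflTransGen_of_seq (fun i hi => (hall i hi).1) (Nat.zero_le _) le_rfl)) hd

lemma IsEssential.isChordal (h : G.IsEssential M) (hG : G.SemiAcyclic) :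
    IsChordal M.undirectedPart := by
  intro v x y c d hx hy hxy hxc hdy hcv hvc hcd
  by_contra hn
  set U := M.undirectedPart
  have hnc : ∀ {a b c : V}, U.Adj a b → U.Adj b c → a ≠ c → ¬ U.Adj a c →
      ¬ (G.head a b ∧ G.head c b) := by
    intro a b c hab hbc hac hn hc
    have hun : Unshielded G.skel a b c := ⟨h.skel ▸ hab.1, h.skel ▸ hbc.1, hac,
      fun h' => hn (h.undir_of_adj hab hbc (h.skel ▸ h'))⟩
    exact hab.2.1 (h.collider hun hc.1 hc.2)
  -- A shortest path from `x` to `y` through vertices outside the closed neighbourhood of `v` forms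
  -- a chordless cycle with `v`.
  let W : V → Prop := fun w => w = x ∨ w = y ∨ (w ≠ v ∧ ¬ U.Adj v w)
  let Γ : SimpleGraph V :=
    { Adj := fun a b => U.Adj a b ∧ W a ∧ W b
      symm := ⟨fun _ _ h => ⟨h.1.symm, h.2.2, h.2.1⟩⟩
      loopless := ⟨fun _ h => h.1.ne rfl⟩ }
  have hWd : W d ∧ Γ.Reachable c d := by
    clear hdy
    induction hcd with
    | refl => exact ⟨Or.inr (Or.inr ⟨hcv, hvc⟩), .rfl⟩
    | @tail e f _ hef ih =>
      have hf : W f := Or.inr (Or.inr hef.2)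
      have hadj : Γ.Adj e f := ⟨hef.1, ih.1, hf⟩
      exact ⟨hf, ih.2.trans hadj.reachable⟩
  have hr : Γ.Reachable x y := by
    have h1 : Γ.Adj x c := ⟨hxc, Or.inl rfl, Or.inr (Or.inr ⟨hcv, hvc⟩)⟩
    have h2 : Γ.Adj d y := ⟨hdy, hWd.1, Or.inr (Or.inl rfl)⟩
    exact h1.reachable.trans (hWd.2.trans h2.reachable)
  obtain ⟨q, hq⟩ := hr.exists_walk_length_eq_dist
  have hpath := q.isPath_of_length_eq_dist hq
  have main : ∀ (k : ℕ) (p : ℕ → V), 2 ≤ k → (∀ i < k, U.Adj (p i) (p (i + 1))) →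
      U.Adj v (p 0) → U.Adj v (p k) → (∀ i, 0 < i → i < k → p i ≠ v ∧ ¬ U.Adj v (p i)) →
      (∀ i, i + 2 ≤ k → p i ≠ p (i + 2) ∧ ¬ U.Adj (p i) (p (i + 2))) → ¬ G.head v (p 0) := by
    intro k p hk hadj h0 hvk hint hchord
    refine hG.no_noncollider_cycle (k := k) (fun i hi => h.skel ▸ (hadj i hi).1)
      (h.skel ▸ hvk.1.symm) ?_ ?_ ?_ (by omega)
    · obtain ⟨h1, h2⟩ := hint 1 one_pos (by omega)
      exact hnc h0 (hadj 0 (by omega)) h1.symm h2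
    · intro i hi
      obtain ⟨h1, h2⟩ := hchord i hi
      exact hnc (hadj i (by omega)) (hadj (i + 1) (by omega)) h1 h2
    · rintro i rfl
      obtain ⟨h1, h2⟩ := hint i (by omega) (by omega)
      exact hnc (hadj i (by omega)) hvk.symm h1 fun h' => h2 h'.symm
  have e0 : q.getVert 0 = x := by simp
  have ek : q.getVert q.length = y := by simp
  have hk : 2 ≤ q.length := by
    rcases hl : q.length with _ | _ | n
    · rw [hl, e0] at ek
      exact (hxy ek).elim
    · have := (q.adj_getVert_succ (i := 0) (by omega)).1
      rw [hl] at ek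
      rw [e0, zero_add, show q.getVert 1 = y from ek] at this
      exact (hn this).elim
    · omega
  have hW : ∀ i ≤ q.length, W (q.getVert i) := by
    intro i hi
    rcases hi.eq_or_lt with rfl | hi
    · rw [ek]; exact Or.inr (Or.inl rfl)
    · exact (q.adj_getVert_succ hi).2.1
  have hadj : ∀ i < q.length, U.Adj (q.getVert i) (q.getVert (i + 1)) :=
    fun i hi => (q.adj_getVert_succ hi).1
  have hint : ∀ i, 0 < i → i < q.length → q.getVert i ≠ v ∧ ¬ U.Adj v (q.getVert i) := by
    intro i h1 h2
    rcases hW i h2.le with h' | h' | h'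
    · have := (hpath.getVert_eq_start_iff h2.le).1 h'
      omega
    · have := (hpath.getVert_eq_end_iff h2.le).1 h'
      omega
    · exact h'
  have hchord : ∀ i, i + 2 ≤ q.length → q.getVert i ≠ q.getVert (i + 2) ∧
      ¬ U.Adj (q.getVert i) (q.getVert (i + 2)) := by
    intro i hi
    obtain ⟨h1, h2⟩ := not_adj_getVert_of_length_eq_dist q hq hi
    exact ⟨h1, fun h' => h2 ⟨h', hW i (by omega), hW _ hi⟩⟩
  -- Traversing the cycle both ways shows that neither edge at `v` has an arrowhead away from `v`.
  -- Then `v` is an unshielded collider on undirected edges.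
  have n1 := main q.length q.getVert hk hadj (by rwa [e0]) (by rwa [ek]) hint hchord
  have n2 := main q.length (fun t => q.getVert (q.length - t)) hk
    (fun i hi => by
      have := (hadj (q.length - (i + 1)) (by omega)).symm
      rwa [show q.length - (i + 1) + 1 = q.length - i by omega] at this)
    (by simpa using hy) (by simpa using hx) (fun i h1 h2 => hint _ (by omega) (by omega))
    (fun i hi => by
      obtain ⟨h1, h2⟩ := hchord (q.length - (i + 2)) (by omega)
      rw [show q.length - (i + 2) + 2 = q.length - i by omega] at h1 h2
      exact ⟨h1.symm, fun h' => h2 h'.symm⟩)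
  simp only [tsub_zero, ek, e0] at n1 n2
  have a1 : G.head x v := (hG.total (h.skel ▸ hx.1)).resolve_left n1
  have a2 : G.head y v := (hG.total (h.skel ▸ hy.1)).resolve_left n2
  exact hnc hx.symm hy hxy hn ⟨a1, a2⟩

end MixedGraph

end MVR

namespace MVR

/-! ### Junction trees -/

section Tree

variable {ι : Type*} {T : SimpleGraph ι}

/-- The neighbour of `X` nearer to the root is the penultimate vertex of the path from `r` to `X`.
-/
lemma eq_of_adj_of_dist_lt (hT : T.IsTree) (r : ι) {X P Q : ι} (hP : T.Adj X P) (hQ : T.Adj X Q)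
    (hPd : T.dist r P < T.dist r X) (hQd : T.dist r Q < T.dist r X) : P = Q := by
  obtain ⟨p, hp, hpl⟩ := hT.connected.exists_path_of_dist r X
  have key : ∀ R, T.Adj X R → T.dist r R < T.dist r X → R = p.penultimate := by
    intro R hR hRd
    obtain ⟨q, hq, hql⟩ := hT.connected.exists_path_of_dist r R
    by_cases hX : X ∈ q.support
    · have := hT.isAcyclic.path_concat hp hq hR hX
      rw [this, SimpleGraph.Walk.length_concat] at hql
      omega
    · exact hT.isAcyclic.eq_penultimate_of_adj_end hp hR
        (hT.isAcyclic.mem_support_of_ne_mem_support_of_adj_of_isPath hp hq hR hX)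
  rw [key P hP hPd, key Q hQ hQd]

/-- A path whose first step leads away from the root can never turn back: the only way down is the
vertex just visited. -/
lemma dist_eq_of_parent_notMem (hT : T.IsTree) (r : ι) {X Y : ι} (q : T.Walk X Y) (hq : q.IsPath)
    (h : ∀ P, T.Adj X P → T.dist r P < T.dist r X → P ∉ q.support) :
    T.dist r Y = T.dist r X + q.length := by
  induction q with
  | nil => simp
  | @cons X X' Y hadj q ih =>
    rw [SimpleGraph.Walk.cons_isPath_iff] at hq
    have hX' : T.dist r X' = T.dist r X + 1 := by
      rcases hT.dist_eq_dist_add_one_of_adj r hadj with h' | h'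
      · exact (h X' hadj (by omega) (by simp)).elim
      · exact h'
    rw [ih hq.1 fun P hP hPd hmem => ?_, hX', SimpleGraph.Walk.length_cons]
    · omega
    · have := eq_of_adj_of_dist_lt hT r hP hadj.symm hPd (by omega)
      exact hq.2 (this ▸ hmem)

lemma exists_parent_mem_support (hT : T.IsTree) (r : ι) {X Y : ι} (q : T.Walk X Y)
    (hq : q.IsPath) (hne : X ≠ Y) (hd : T.dist r Y ≤ T.dist r X) :
    ∃ P, T.Adj X P ∧ T.dist r P < T.dist r X ∧ P ∈ q.support := by
  by_contra hcon
  push Not at hcon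
  have h1 := dist_eq_of_parent_notMem hT r q hq hcon
  have h2 : q.length ≠ 0 := fun h0 => hne (SimpleGraph.Walk.eq_of_length_eq_zero h0)
  omega

/-- The tree given by a parent function. -/
def parentTree (root : ι) (par : ι → ι) (h : ∀ C, C ≠ root → par C ≠ C) : SimpleGraph ι where
  Adj C D := (C ≠ root ∧ D = par C) ∨ (D ≠ root ∧ C = par D)
  symm := ⟨fun _ _ h => h.symm⟩
  loopless := ⟨fun C h' => h'.elim (fun h' => h C h'.1 h'.2.symm) fun h' => h C h'.1 h'.2.symm⟩

/-- Decreasing `idx` connects everything to the root, and each edge belongs to a non-root vertex, so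
there are few enough edges for a tree. -/
lemma isTree_parentTree [Finite ι] {root : ι} {par : ι → ι} (idx : ι → ℕ)
    (hidx : ∀ C, C ≠ root → idx (par C) < idx C) (h : ∀ C, C ≠ root → par C ≠ C) :
    (parentTree root par h).IsTree := by
  set T := parentTree root par h
  have hr : ∀ n C, idx C = n → T.Reachable C root := by
    intro n
    induction n using Nat.strong_induction_on with
    | _ n ih =>
    rintro C rfl
    by_cases hC : C = root
    · exact hC ▸ .rfl
    · have hadj : T.Adj C (par C) := Or.inl ⟨hC, rfl⟩
      exact hadj.reachable.trans (ih _ (hidx C hC) _ rfl)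
  have : Nonempty ι := ⟨root⟩
  have hconn : T.Connected := ⟨fun C D => (hr _ C rfl).trans (hr _ D rfl).symm⟩
  rw [SimpleGraph.isTree_iff_connected_and_card]
  refine ⟨hconn, le_antisymm ?_ hconn.card_vert_le_card_edgeSet_add_one⟩
  have hsub : T.edgeSet ⊆ (fun C => s(C, par C)) '' {root}ᶜ := by
    intro e
    induction e using Sym2.ind with
    | _ C D =>
    rintro (⟨h1, h2⟩ | ⟨h1, h2⟩)
    · exact ⟨C, h1, congrArg (fun x => s(C, x)) h2.symm⟩
    · exact ⟨D, h1, Sym2.eq_swap.trans (congrArg (fun x => s(x, D)) h2.symm)⟩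
  have h1 := Set.ncard_le_ncard hsub (Set.toFinite _)
  have h2 := Set.ncard_image_le (s := {root}ᶜ) (f := fun C => s(C, par C)) (Set.toFinite _)
  have h3 := Set.ncard_add_ncard_compl ({root} : Set ι)
  rw [Set.ncard_singleton] at h3
  rw [Nat.card_coe_set_eq]
  omega

end Tree

section JunctionOrder

variable {V : Type*} {U : SimpleGraph V}

lemma exists_maxClique_superset [Finite V] {K : Set V} (hK : U.IsClique K) : ∃ C : MaxClique U, K ⊆ C.1 := by
  obtain ⟨C, hKC, hC⟩ := Finite.exists_le_maximal hK
  exact ⟨⟨C, hC⟩, hKC⟩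

lemma exists_isFirstClique [Finite V] (rank : MaxClique U → ℕ) (x : V) : ∃ C, IsFirstClique rank x C := by
  obtain ⟨C, hC⟩ := exists_maxClique_superset (U := U) (K := {x}) (by simp)
  have hne : ∃ n, ∃ C : MaxClique U, x ∈ C.1 ∧ rank C = n := ⟨_, C, by simpa using hC, rfl⟩
  classical
  obtain ⟨D, hD, hr⟩ := Nat.find_spec hne
  exact ⟨D, hD, fun E hE => hr.trans_le (Nat.find_min' hne ⟨E, hE, rfl⟩)⟩

/-- Move a common clique `D` towards the root. While it is neither `Cx` nor `Cy`, its parent lies on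
the paths to both and contains `x` and `y` by running intersection. If `Cx` is met, it contains `y`,
hence equals `Cy`. -/
lemma mem_of_isFirstClique {T : SimpleGraph (MaxClique U)} {root : MaxClique U}
    {rank : MaxClique U → ℕ} (hT : IsJunctionTree U T) (hinj : Function.Injective rank)
    (hrank : ∀ C D, T.dist root C < T.dist root D → rank C < rank D) {x y : V}
    {Cx Cy : MaxClique U} (hx : IsFirstClique rank x Cx) (hy : IsFirstClique rank y Cy)
    (hle : rank Cx ≤ rank Cy) (D : MaxClique U) (hxD : x ∈ D.1) (hyD : y ∈ D.1) : x ∈ Cy.1 := by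
  have hdist : ∀ {z : V} {C : MaxClique U}, IsFirstClique rank z C → ∀ D : MaxClique U, z ∈ D.1 →
      T.dist root C ≤ T.dist root D := by
    intro z C hC D hD
    by_contra hlt
    exact absurd (hrank D C (not_le.1 hlt)) (hC.2 D hD).not_gt
  have hpar : ∀ {z : V} {C : MaxClique U}, IsFirstClique rank z C → ∀ D : MaxClique U, z ∈ D.1 →
      D ≠ C → ∃ P, T.Adj D P ∧ T.dist root P < T.dist root D ∧ z ∈ P.1 := by
    intro z C hC D hD hne
    obtain ⟨q, hq, -⟩ := hT.isTree.connected.exists_path_of_dist D C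
    obtain ⟨P, h1, h2, h3⟩ := exists_parent_mem_support hT.isTree root q hq hne (hdist hC D hD)
    exact ⟨P, h1, h2, hT.running D C q hq P h3 ⟨hD, hC.1⟩⟩
  induction hn : T.dist root D using Nat.strong_induction_on generalizing D with
  | _ n ih =>
  by_cases h1 : D = Cy
  · exact h1 ▸ hxD
  by_cases h2 : D = Cx
  · subst h2
    exact hinj (le_antisymm hle (hy.2 D hyD)) ▸ hxD
  obtain ⟨P, hP1, hP2, hP3⟩ := hpar hy D hyD h1
  obtain ⟨Q, hQ1, hQ2, hQ3⟩ := hpar hx D hxD h2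
  obtain rfl := eq_of_adj_of_dist_lt hT.isTree root hP1 hQ1 hP2 hQ2
  exact ih _ (hn ▸ hP2) P hQ3 hP3 rfl

lemma IsJunctionOrder.perfectOrder [Finite V] {ord : V → ℕ} (h : IsJunctionOrder U ord) :
    PerfectOrder U ord := by
  obtain ⟨hinj, T, root, rank, hT, hrinj, hrank, hord⟩ := h
  refine ⟨hinj, fun {x y z} hxy hzy hx hz hxz => ?_⟩
  obtain ⟨Cy, hy⟩ := exists_isFirstClique rank y
  have key : ∀ {x}, U.Adj x y → ord x < ord y → x ∈ Cy.1 := by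
    intro x hxy hlt
    obtain ⟨Cx, hx⟩ := exists_isFirstClique rank x
    obtain ⟨D, hD⟩ := exists_maxClique_superset (U := U) (K := {x, y}) (by
      rw [SimpleGraph.isClique_pair]
      exact fun _ => hxy)
    refine mem_of_isFirstClique hT hrinj hrank hx hy ?_ D (hD (by simp)) (hD (by simp))
    by_contra hr
    exact absurd (hord y x Cy Cx hy hx (not_le.1 hr)) hlt.not_gt
  exact Cy.2.prop (key hxy hx) (key hzy hz) hxz

end JunctionOrder

/-! ### Chordal graphs have junction trees -/

section Chordal

variable {V : Type*} {U : SimpleGraph V}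

/-- The neighbours of `s` in `W` form a clique. -/
def IsSimplicialIn (U : SimpleGraph V) (W : Set V) (s : V) : Prop :=
  ∀ a ∈ W, ∀ b ∈ W, U.Adj s a → U.Adj s b → a ≠ b → U.Adj a b

/-- Dirac's argument. Let `C` be the component of `w` off the closed neighbourhood of `t`, and `S`
its attachments among the neighbours of `t`. By chordality `S` is a clique. A vertex of `C` that is
simplicial in the smaller set `C ∪ S` is simplicial in `W`. -/
lemma IsChordal.exists_nonadj_simplicial [Finite V] (hU : IsChordal U) (W : Set V) {t w : V}
    (ht : t ∈ W) (hw : w ∈ W) (hwt : w ≠ t) (hn : ¬ U.Adj t w) :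
    ∃ s ∈ W, s ≠ t ∧ ¬ U.Adj t s ∧ IsSimplicialIn U W s := by
  induction hcard : W.ncard using Nat.strong_induction_on generalizing W t w with
  | _ n ih =>
  subst hcard
  set r : V → V → Prop := fun a b => U.Adj a b ∧ b ∈ W ∧ b ≠ t ∧ ¬ U.Adj t b
  set C : Set V := {c | Relation.ReflTransGen r w c}
  have hCW : ∀ c ∈ C, (c ∈ W ∧ c ≠ t ∧ ¬ U.Adj t c) ∧ Relation.ReflTransGen r c w := by
    intro c hc
    induction (show Relation.ReflTransGen r w c from hc) with
    | refl => exact ⟨⟨hw, hwt, hn⟩, .refl⟩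
    | @tail b c hb hbc ih =>
      obtain ⟨h1, h2⟩ := ih hb
      exact ⟨hbc.2, h2.head ⟨hbc.1.symm, h1⟩⟩
  set S : Set V := {s | s ∈ W ∧ U.Adj t s ∧ ∃ c ∈ C, U.Adj s c}
  have hSclique : ∀ x ∈ S, ∀ y ∈ S, x ≠ y → U.Adj x y := by
    rintro x ⟨-, hx, c, hc, hxc⟩ y ⟨-, hy, d, hd, hyd⟩ hxy
    refine hU t x y c d hx hy hxy hxc hyd.symm (hCW c hc).1.2.1 (hCW c hc).1.2.2 ?_
    exact Relation.ReflTransGen.mono (fun a b h => ⟨h.1, h.2.2⟩) _ _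
      ((hCW c hc).2.trans (show Relation.ReflTransGen r w d from hd))
  have hnbr : ∀ c ∈ C, ∀ b ∈ W, U.Adj c b → b ∈ C ∪ S := by
    intro c hc b hb hcb
    by_cases hbt : U.Adj t b
    · exact Or.inr ⟨hb, hbt, c, hc, hcb.symm⟩
    · refine Or.inl (Relation.ReflTransGen.tail (show Relation.ReflTransGen r w c from hc)
        ⟨hcb, hb, ?_, hbt⟩)
      rintro rfl
      exact (hCW c hc).1.2.2 hcb.symm
  have hdone : ∀ s ∈ C, IsSimplicialIn U (C ∪ S) s →
      ∃ s ∈ W, s ≠ t ∧ ¬ U.Adj t s ∧ IsSimplicialIn U W s := by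
    intro s hs hsimp
    refine ⟨s, (hCW s hs).1.1, (hCW s hs).1.2.1, (hCW s hs).1.2.2, fun a ha b hb hsa hsb => ?_⟩
    exact hsimp a (hnbr s hs a ha hsa) b (hnbr s hs b hb hsb) hsa hsb
  have hlt : (C ∪ S).ncard < W.ncard := by
    refine Set.ncard_lt_ncard ?_ (Set.toFinite _)
    rw [Set.ssubset_iff_of_subset (Set.union_subset (fun c hc => (hCW c hc).1.1) fun s hs => hs.1)]
    refine ⟨t, ht, ?_⟩
    rintro (h' | h')
    · exact (hCW t h').1.2.1 rfl
    · exact h'.2.1.ne rfl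
  -- A nonadjacent pair in `C ∪ S` permits induction, starting in `S` if possible so that the vertex
  -- obtained avoids the clique `S`. If there is no such pair, `w` itself is simplicial.
  by_cases h1 : ∃ s ∈ S, ∃ e ∈ C ∪ S, e ≠ s ∧ ¬ U.Adj s e
  · obtain ⟨s, hs, e, he, hes, hse⟩ := h1
    obtain ⟨s', h1, h2, h3, h4⟩ := ih _ hlt (C ∪ S) (Or.inr hs) he hes hse rfl
    refine hdone s' (h1.resolve_right fun h' => ?_) h4
    exact h3 (hSclique s hs s' h' h2.symm)
  push Not at h1
  by_cases h2 : ∃ c ∈ C, ∃ e ∈ C ∪ S, e ≠ c ∧ ¬ U.Adj c e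
  · obtain ⟨c, hc, e, he, hec, hce⟩ := h2
    obtain ⟨s', g1, g2, g3, g4⟩ := ih _ hlt (C ∪ S) (Or.inl hc) he hec hce rfl
    refine hdone s' (g1.resolve_right fun h' => ?_) g4
    exact g3 (h1 s' h' c (Or.inl hc) g2.symm).symm
  push Not at h2
  refine hdone w (show Relation.ReflTransGen r w w from .refl) fun a ha b hb _ _ hab => ?_
  rcases ha with ha | ha
  · exact h2 a ha b hb hab.symm
  · exact h1 a ha b hb hab.symm

lemma IsChordal.exists_simplicial [Finite V] (hU : IsChordal U) {W : Set V} (hW : W.Nonempty) :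
    ∃ s ∈ W, IsSimplicialIn U W s := by
  by_cases h : ∃ t ∈ W, ∃ w ∈ W, w ≠ t ∧ ¬ U.Adj t w
  · obtain ⟨t, ht, w, hw, hwt, hn⟩ := h
    obtain ⟨s, hs, -, -, hsimp⟩ := hU.exists_nonadj_simplicial W ht hw hwt hn
    exact ⟨s, hs, hsimp⟩
  · push Not at h
    obtain ⟨s, hs⟩ := hW
    exact ⟨s, hs, fun a ha b hb _ _ hab => h a ha b hb hab.symm⟩

/-- `c 0, …, c (n - 1)` lists the maximal cliques of `U` in `W`, with the running intersection
property. -/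
structure CliqueList (U : SimpleGraph V) (W : Set V) (n : ℕ) (c : ℕ → Set V) : Prop where
  subset : ∀ i < n, c i ⊆ W
  isClique : ∀ i < n, U.IsClique (c i)
  exists_superset : ∀ K : Set V, K ⊆ W → U.IsClique K → ∃ i < n, K ⊆ c i
  eq_of_subset : ∀ i < n, ∀ j < n, c i ⊆ c j → i = j
  running : ∀ j < n, 0 < j → ∃ i < j, ∀ k < j, c j ∩ c k ⊆ c i

/-- The only maximal clique through `x` consists of `x` and its neighbours `N`. It replaces `N` if
`N` was listed and is appended otherwise. Since `x` is in no other clique, running intersection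
survives. -/
lemma CliqueList.insert_simplicial {W : Set V} {n : ℕ} {c : ℕ → Set V} (h : CliqueList U W n c) {x : V}
    (hx : x ∉ W) (hsimp : IsSimplicialIn U (insert x W) x) :
    ∃ m d, CliqueList U (insert x W) m d := by
  classical
  set N : Set V := {a | a ∈ W ∧ U.Adj x a}
  have hNc : U.IsClique N := fun a ha b hb hab =>
    hsimp a (Or.inr ha.1) b (Or.inr hb.1) ha.2 hb.2 hab
  have hxN : U.IsClique (insert x N) := by
    rw [SimpleGraph.isClique_insert]
    exact ⟨hNc, fun b hb _ => hb.2⟩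
  have hxc : ∀ i < n, x ∉ c i := fun i hi hxi => hx (h.subset i hi hxi)
  have hKN : ∀ K : Set V, K ⊆ insert x W → U.IsClique K → x ∈ K → K ⊆ insert x N := by
    intro K hK hKc hxK a ha
    by_cases hax : a = x
    · exact Or.inl hax
    · exact Or.inr ⟨(hK ha).resolve_left hax, hKc hxK ha fun h' => hax h'.symm⟩
  have hKW : ∀ K : Set V, K ⊆ insert x W → x ∉ K → K ⊆ W := fun K hK hxK a ha =>
    (hK ha).resolve_left fun h' => hxK (h' ▸ ha)
  obtain ⟨i₀, hi₀, hNi⟩ := h.exists_superset N (fun a ha => ha.1) hNc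
  by_cases heq : c i₀ = N
  · have d0 : Function.update c i₀ (insert x N) i₀ = insert x N := Function.update_self ..
    have d1 : ∀ i, i ≠ i₀ → Function.update c i₀ (insert x N) i = c i :=
      fun i hi => Function.update_of_ne hi ..
    generalize Function.update c i₀ (insert x N) = d at d0 d1
    have hcd : ∀ i, c i ⊆ d i := by
      intro i
      by_cases hi : i = i₀
      · rw [hi, d0, heq]
        exact Set.subset_insert x N
      · rw [d1 i hi]
    have hdc : ∀ i, d i ⊆ insert x (c i) := by
      intro i
      by_cases hi : i = i₀
      · rw [hi, d0, heq]
      · rw [d1 i hi]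
        exact Set.subset_insert x _
    have hxd : ∀ i < n, x ∈ d i → i = i₀ := by
      intro i hi hxi
      by_contra hne
      rw [d1 i hne] at hxi
      exact hxc i hi hxi
    refine ⟨n, d, fun i hi => (hdc i).trans (Set.insert_subset_insert (h.subset i hi)), ?_, ?_, ?_,
      ?_⟩
    · intro i hi
      by_cases hne : i = i₀
      · rw [hne, d0]
        exact hxN
      · rw [d1 i hne]
        exact h.isClique i hi
    · intro K hK hKc
      by_cases hxK : x ∈ K
      · exact ⟨i₀, hi₀, d0 ▸ hKN K hK hKc hxK⟩
      · obtain ⟨i, hi, hKi⟩ := h.exists_superset K (hKW K hK hxK) hKc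
        exact ⟨i, hi, hKi.trans (hcd i)⟩
    · intro i hi j hj hij
      refine h.eq_of_subset i hi j hj fun a ha => ?_
      rcases hdc j (hij (hcd i ha)) with rfl | h'
      · exact (hxc i hi ha).elim
      · exact h'
    · intro j hj hj0
      obtain ⟨i, hi, hrun⟩ := h.running j hj hj0
      refine ⟨i, hi, fun k hk a ha => ?_⟩
      rcases hdc j ha.1 with rfl | h1
      · have e1 := hxd j hj ha.1
        have e2 := hxd k (hk.trans hj) ha.2
        omega
      rcases hdc k ha.2 with rfl | h2
      · exact (hxc j hj h1).elim
      exact hcd i (hrun k hk ⟨h1, h2⟩)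
  · have d0 : Function.update c n (insert x N) n = insert x N := Function.update_self ..
    have d1 : ∀ i < n, Function.update c n (insert x N) i = c i :=
      fun i hi => Function.update_of_ne hi.ne ..
    generalize Function.update c n (insert x N) = d at d0 d1
    have hcases : ∀ i < n + 1, i < n ∨ i = n := fun i hi => Nat.lt_succ_iff_lt_or_eq.1 hi
    refine ⟨n + 1, d, ?_, ?_, ?_, ?_, ?_⟩
    · intro i hi
      rcases hcases i hi with hi | rfl
      · rw [d1 i hi]
        exact (h.subset i hi).trans (Set.subset_insert x W)
      · rw [d0]
        exact Set.insert_subset_insert fun a ha => ha.1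
    · intro i hi
      rcases hcases i hi with hi | rfl
      · rw [d1 i hi]
        exact h.isClique i hi
      · rw [d0]
        exact hxN
    · intro K hK hKc
      by_cases hxK : x ∈ K
      · exact ⟨n, Nat.lt_succ_self n, d0 ▸ hKN K hK hKc hxK⟩
      · obtain ⟨i, hi, hKi⟩ := h.exists_superset K (hKW K hK hxK) hKc
        exact ⟨i, hi.trans (Nat.lt_succ_self n), (d1 i hi).symm ▸ hKi⟩
    · intro i hi j hj hij
      rcases hcases i hi with hi | rfl <;> rcases hcases j hj with hj | rfl
      · rw [d1 i hi, d1 j hj] at hij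
        exact h.eq_of_subset i hi j hj hij
      · rw [d1 i hi, d0] at hij
        have hiN : c i ⊆ N := fun a ha => (hij ha).resolve_left fun h' => hxc i hi (h' ▸ ha)
        obtain rfl := h.eq_of_subset i hi i₀ hi₀ (hiN.trans hNi)
        exact (heq (hiN.antisymm hNi)).elim
      · rw [d0, d1 j hj] at hij
        exact (hxc j hj (hij (Set.mem_insert x N))).elim
      · rfl
    · intro j hj hj0
      rcases hcases j hj with hj | rfl
      · obtain ⟨i, hi, hrun⟩ := h.running j hj hj0
        refine ⟨i, hi, fun k hk => ?_⟩
        rw [d1 j hj, d1 k (hk.trans hj), d1 i (hi.trans hj)]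
        exact hrun k hk
      · refine ⟨i₀, hi₀, fun k hk => ?_⟩
        rw [d0, d1 k hk, d1 i₀ hi₀]
        rintro a ⟨rfl | h1, h2⟩
        · exact (hxc k hk h2).elim
        · exact hNi h1

lemma IsChordal.exists_cliqueList [Finite V] (hU : IsChordal U) (W : Set V) :
    ∃ n c, CliqueList U W n c := by
  induction hcard : W.ncard generalizing W with
  | zero =>
    rw [Set.ncard_eq_zero (Set.toFinite _)] at hcard
    subst hcard
    -- The empty set is a maximal clique here, so the list is never empty and a root always exists.
    exact ⟨1, fun _ => ∅, by simp, by simp, fun K hK _ => ⟨0, one_pos, hK⟩,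
      fun i hi j hj _ => by omega, fun j hj h0 => by omega⟩
  | succ m ih =>
    have hW : W.Nonempty := by
      rw [← Set.ncard_pos (Set.toFinite _)]
      omega
    obtain ⟨x, hx, hsimp⟩ := hU.exists_simplicial hW
    have hins : insert x (W \ {x}) = W := by
      rw [Set.insert_sdiff_singleton, Set.insert_eq_of_mem hx]
    obtain ⟨n, c, hc⟩ := ih (W \ {x}) (by
      rw [Set.ncard_sdiff_singleton_of_mem hx]
      omega)
    have := hc.insert_simplicial (x := x) (by simp) (hins.symm ▸ hsimp)
    rwa [hins] at this

/-- The parent of a clique is the earlier one supplied by running intersection. From any clique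
containing `y`, parents lead to the earliest such clique without losing `y`, so the cliques
containing `y` are connected in the tree. -/
lemma IsChordal.exists_isJunctionTree [Finite V] (hU : IsChordal U) :
    ∃ T : SimpleGraph (MaxClique U), IsJunctionTree U T := by
  classical
  obtain ⟨n, c, hc⟩ := hU.exists_cliqueList Set.univ
  have hmax : ∀ i < n, Maximal U.IsClique (c i) := by
    refine fun i hi => ⟨hc.isClique i hi, fun K hK hiK => ?_⟩
    obtain ⟨j, hj, hKj⟩ := hc.exists_superset K (Set.subset_univ _) hK
    obtain rfl := hc.eq_of_subset i hi j hj (hiK.trans hKj)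
    exact hKj
  have hidx : ∀ C : MaxClique U, ∃ i, i < n ∧ c i = C.1 := by
    intro C
    obtain ⟨i, hi, hCi⟩ := hc.exists_superset C.1 (Set.subset_univ _) C.2.prop
    exact ⟨i, hi, (C.2.eq_of_subset (hc.isClique i hi) hCi).symm⟩
  choose idx hlt hcidx using hidx
  have hinj : ∀ {C D : MaxClique U}, idx C = idx D → C = D := by
    intro C D hCD
    exact Subtype.ext ((hcidx C).symm.trans ((congrArg c hCD).trans (hcidx D)))
  have hn : 0 < n := by
    obtain ⟨i, hi, -⟩ := hc.exists_superset ∅ (Set.subset_univ _) (by simp)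
    omega
  have hof : ∀ i (hi : i < n), idx ⟨c i, hmax i hi⟩ = i := fun i hi =>
    hc.eq_of_subset _ (hlt _) _ hi (hcidx ⟨c i, hmax i hi⟩).le
  set root : MaxClique U := ⟨c 0, hmax 0 hn⟩
  have hpar : ∀ C : MaxClique U, ∃ P : MaxClique U, C ≠ root →
      idx P < idx C ∧ ∀ D : MaxClique U, idx D < idx C → C.1 ∩ D.1 ⊆ P.1 := by
    intro C
    by_cases hC : C = root
    · exact ⟨root, fun h => (h hC).elim⟩
    · have h0 : 0 < idx C := by
        refine Nat.pos_of_ne_zero fun h0 => hC (hinj ?_)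
        rw [h0, hof 0 hn]
      obtain ⟨i, hi, hrun⟩ := hc.running (idx C) (hlt C) h0
      refine ⟨⟨c i, hmax i (hi.trans (hlt C))⟩, fun _ => ⟨by rwa [hof i (hi.trans (hlt C))], fun D hD => ?_⟩⟩
      have := hrun (idx D) hD
      rwa [hcidx, hcidx] at this
  choose par hpar using hpar
  have hne : ∀ C, C ≠ root → par C ≠ C := fun C hC he => by
    have := (hpar C hC).1
    rw [he] at this
    omega
  have hT := isTree_parentTree idx (fun C hC => (hpar C hC).1) hne
  set T := parentTree root par hne
  refine ⟨T, hT, fun C D q hq B hB y hy => ?_⟩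
  have hex : ∃ k, ∃ A : MaxClique U, y ∈ A.1 ∧ idx A = k := ⟨_, C, hy.1, rfl⟩
  obtain ⟨A, hA, hAk⟩ := Nat.find_spec hex
  have hmin : ∀ E : MaxClique U, y ∈ E.1 → idx A ≤ idx E := fun E hE =>
    hAk.trans_le (Nat.find_min' hex ⟨E, hE, rfl⟩)
  have hup : ∀ k, ∀ E : MaxClique U, idx E = k → y ∈ E.1 →
      ∃ w : T.Walk E A, ∀ F ∈ w.support, y ∈ F.1 := by
    intro k
    induction k using Nat.strong_induction_on with
    | _ k ih =>
    rintro E rfl hE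
    by_cases hEA : E = A
    · subst hEA
      exact ⟨.nil, by simpa using hE⟩
    have hlt' : idx A < idx E := lt_of_le_of_ne (hmin E hE) fun h => hEA (hinj h.symm)
    have hEr : E ≠ root := by
      rintro rfl
      rw [hof 0 hn] at hlt'
      omega
    obtain ⟨h1, h2⟩ := hpar E hEr
    obtain ⟨w, hw⟩ := ih _ h1 (par E) rfl (h2 A hlt' ⟨hE, hA⟩)
    have hadj : T.Adj E (par E) := Or.inl ⟨hEr, rfl⟩
    refine ⟨.cons hadj w, fun F hF => ?_⟩
    rw [SimpleGraph.Walk.support_cons, List.mem_cons] at hF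
    rcases hF with rfl | hF
    · exact hE
    · exact hw F hF
  obtain ⟨w₁, hw₁⟩ := hup _ C rfl hy.1
  obtain ⟨w₂, hw₂⟩ := hup _ D rfl hy.2
  have hq' : q = (w₁.append w₂.reverse).bypass :=
    (hT.existsUnique_path C D).unique hq (SimpleGraph.Walk.bypass_isPath _)
  rw [hq'] at hB
  have hB' := SimpleGraph.Walk.support_bypass_subset_support _ hB
  rw [SimpleGraph.Walk.mem_support_append_iff, SimpleGraph.Walk.support_reverse,
    List.mem_reverse] at hB'
  exact hB'.elim (hw₁ B) (hw₂ B)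

lemma exists_injective_nat_of_measure {ι : Type*} [Finite ι] (f : ι → ℕ) :
    ∃ g : ι → ℕ, Function.Injective g ∧ ∀ a b, f a < f b → g a < g b := by
  obtain ⟨n, ⟨e⟩⟩ := Finite.exists_equiv_fin ι
  -- Lexicographic order: `f` first, ties broken by an enumeration.
  refine ⟨fun a => f a * n + e a, fun a b hab => ?_, fun a b hab => ?_⟩
  · have h1 : (f a * n + e a) % n = (f b * n + e b) % n := congrArg (· % n) hab
    rw [Nat.mul_add_mod', Nat.mul_add_mod', Nat.mod_eq_of_lt (e a).2,
      Nat.mod_eq_of_lt (e b).2] at h1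
    exact e.injective (Fin.ext h1)
  · have h1 := (e a).2
    have h2 : f a * n + n ≤ f b * n := by
      rw [← Nat.succ_mul]
      exact Nat.mul_le_mul_right n hab
    show f a * n + e a < f b * n + e b
    omega

lemma IsChordal.exists_isJunctionOrder [Finite V] (hU : IsChordal U) :
    ∃ ord : V → ℕ, IsJunctionOrder U ord := by
  obtain ⟨T, hT⟩ := hU.exists_isJunctionTree
  obtain ⟨root⟩ := hT.isTree.connected.nonempty
  obtain ⟨rank, hrinj, hrank⟩ := exists_injective_nat_of_measure (T.dist root)
  choose first hfirst using exists_isFirstClique rank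
  obtain ⟨ord, hinj, hord⟩ := exists_injective_nat_of_measure fun x => rank (first x)
  have huniq : ∀ {x C}, IsFirstClique rank x C → C = first x := fun {x C} hC =>
    hrinj (le_antisymm (hC.2 _ (hfirst x).1) ((hfirst x).2 _ hC.1))
  exact ⟨ord, hinj, T, root, rank, hT, hrinj, hrank, fun x y C D hC hD hlt =>
    hord x y (huniq hC ▸ huniq hD ▸ hlt)⟩

end Chordal

end MVR

/-! ### Correctness of the algorithms -/

namespace MVR

lemma Faithful.oracle {V : Type*} [Fintype V] {E : V → Type*} [∀ v, MeasurableSpace (E v)]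
    [∀ v, StandardBorelSpace (E v)] {p : Measure (∀ v, E v)} [IsProbabilityMeasure p]
    {G : MixedGraph V} (hp : Faithful p G) {ci : V → V → Set V → Prop}
    (hci : ∀ (u v : V) (S : Set V), u ≠ v → u ∉ S → v ∉ S → (ci u v S ↔ CI p {u} {v} S)) :
    Oracle G ci := fun u v S huv hu hv =>
  (hci u v S huv hu hv).trans (hp _ _ _ (admissible_singleton huv hu hv))

section

variable {V : Type*} [Fintype V] {G : MixedGraph V} {ci : V → V → Set V → Prop}
  {rule : TripleRule}

lemma exists_isOutput (hci : Oracle G ci) (hG : G.SemiAcyclic) (hrule : rule.Valid)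
    (ver : SkeletonVersion) : ∃ N amb, IsOutput ci rule ver N amb := by
  obtain ⟨H, hH⟩ := exists_skeletonUpTo ci ver (Fintype.card V - 1)
  obtain rfl := SkeletonResult.eq hci hG hH
  obtain ⟨M, hM⟩ := MixedGraph.exists_runsTo_ruleStep (ci := ci) (rule := rule) G.skel
    (vStructureGraph ci rule G.skel)
  obtain ⟨ord, hord⟩ :=
    ((MixedGraph.isEssential_of_runsTo hci hG hrule hM).isChordal hG).exists_isJunctionOrder
  exact ⟨_, _, G.skel, M, ord, hH, hM, hord, rfl, rfl⟩

lemma IsOutput.correct (hci : Oracle G ci) (hG : G.SemiAcyclic) (hrule : rule.Valid)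
    {ver : SkeletonVersion} {N : MixedGraph V} {amb : Set (V × V × V)}
    (h : IsOutput ci rule ver N amb) :
    N.IsMVRCG ∧ MarkovEquiv G N ∧ HasMinimumBidirected N ∧ amb = ∅ := by
  obtain ⟨H, M, ord, hH, hM, hord, rfl, rfl⟩ := h
  obtain rfl := SkeletonResult.eq hci hG hH
  have hess := MixedGraph.isEssential_of_runsTo hci hG hrule hM
  have hN := hess.semiAcyclic_orient hG hord.1
  have hGN := hess.samePattern_orient hG hord.perfectOrder
  refine ⟨hN.isMVRCG, hGN.markovEquiv hG hN, fun K hK hNK => ?_,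
    ambiguousTriples_eq_empty hci hG hrule⟩
  exact hess.bidirEdges_orient_subset hK.semiAcyclic
    (hGN.trans (hNK.samePattern hN hK.semiAcyclic))

end

end MVR

theorem theorem3 {V : Type*} [Fintype V] {E : V → Type*} [∀ v, MeasurableSpace (E v)]
    [∀ v, StandardBorelSpace (E v)]
    (p : MeasureTheory.Measure (∀ v, E v)) [MeasureTheory.IsProbabilityMeasure p]
    (G : MVR.MixedGraph V) (hG : G.IsMVRCG) (hp : MVR.Faithful p G)
    (ci : V → V → Set V → Prop)
    (hci : ∀ (u v : V) (S : Set V), u ≠ v → u ∉ S → v ∉ S → (ci u v S ↔ MVR.CI p {u} {v} S))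
    (ver : MVR.SkeletonVersion) (rule : MVR.TripleRule) (hrule : rule.Valid) :
    (∀ u w v, MVR.Unshielded G.skel u w v →
      (∀ S : Set V, u ∉ S → v ∉ S → G.MSep {u} {v} S → w ∈ S) ∨
      (∀ S : Set V, u ∉ S → v ∉ S → G.MSep {u} {v} S → w ∉ S)) ∧
    (∃ N amb, MVR.IsOutput ci rule ver N amb) ∧
    ∀ N amb, MVR.IsOutput ci rule ver N amb →
      N.IsMVRCG ∧ MVR.MarkovEquiv G N ∧ MVR.HasMinimumBidirected N ∧ amb = ∅ := by
  have hA := hG.semiAcyclic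
  have ho := hp.oracle hci
  refine ⟨fun u w v h => ?_, MVR.exists_isOutput ho hA hrule ver,
    fun N amb h => h.correct ho hA hrule⟩
  by_cases hc : G.head u w ∧ G.head v w
  · exact Or.inr fun S hu hv hs => MVR.MixedGraph.notMem_of_collider_of_mSep h hu hv hs hc
  · refine Or.inl fun S hu hv hs => ?_
    by_contra hw
    exact hc (MVR.MixedGraph.collider_of_mSep_of_notMem h hu hv hs hw)
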